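/- **Setting.** Let $b,c\in\mathbb R^d$ and $\mathcal X=\prod_{j=1}^d[b_j,c_j]$. Let $Q$ be the law of $(Y(1),Y(0),X)$ on $\mathbb R\times\mathbb R\times\mathcal X$, and assume: (a) for some $M<\infty$, $Y(a)\in[-M,M]$ almost surely for $a\in\{0,1\}$, and the law of each $Y(a)$ either has no atoms or has finite support; (b) $X=(X_C,X_D)$ for a splitting of the coordinates into two groups, where $X_C$ has a bounded density that is strictly positive on its rectangle and $X_D$ has finite support. *Trees.* Let $L$ be a positive integer and $K=2^L$. A tree partition of depth $L$ is obtained by cutting $\mathcal X$ recursively $L$ times, where each piece $\Gamma$ is cut into $\{x\in\Gamma:x_j\le\gamma\}$ and $\{x\in\Gamma:x_j>\gamma\}$ with $j,\gamma$ depending on the piece (pieces may be empty). A stratification tree is a pair $T=(S,\pi)$ with $\pi\in[0,1]^K$ and $S:\mathcal X\to\{1,\dots,K\}$ a labelling of the $K$ leaves of a tree partition by distinct labels. Let $\rho(T,T')=\sum_kP\big(X\in S^{-1}(k)\,\Delta\,S'^{-1}(k)\big)+\|\pi-\pi'\|_2$; trees at distance $0$ are identified when closedness is considered. Let $\mathcal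 T$ be a nonempty countable set of stratification trees of depth $L$ such that, for some fixed $\nu,\delta>0$, every $T=(S,\pi)\in\mathcal T$ and every $k$ with $S^{-1}(k)\neq\emptyset$ satisfy $\pi(k)\in[\nu,1-\nu]$ and $P(S(X)=k)>\delta$. Put $$V(T)=\sum_{k=1}^KP(S(X)=k)\Big[\big(E[Y(1)-Y(0)\mid S(X)=k]-E[Y(1)-Y(0)]\big)^2+\frac{\sigma_0^2(k)}{1-\pi(k)}+\frac{\sigma_1^2(k)}{\pi(k)}\Big],\qquad V^*=\inf_{T\in\mathcal T}V(T),$$ where $\sigma_a^2(k)=E[Y(a)^2\mid S(X)=k]-E[Y(a)\mid S(X)=k]^2$; strata of probability $0$ contribute $0$. *Pilot data.* Let $(Y_j(1),Y_j(0),X_j)$, $j\ge1$, be i.i.d. from $Q$, and let the treatments $A_j\in\{0,1\}$ be i.i.d. with $P(A_j=1)=p\in(0,1)$, independent of all $(Y_i(1),Y_i(0),X_i)$ (simple random assignment). Let $Y_j=Y_j(1)A_j+Y_j(0)(1-A_j)$ and $W_j=(Y_j,A_j,X_j)$; the pilot data of size $m$ are $W_1,\dots,W_m$. With $m(k;T)=\#\{j\le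 m:S(X_j)=k\}$ and $\hat E_a[g\mid k]$ the average of $g(Y_j)$ over the $j\le m$ with $A_j=a$, $S(X_j)=k$ (and $0$ if there are none), put $$\widetilde V_m(T)=\sum_{k=1}^K\frac{m(k;T)}m\Big[\big(\hat E_1[y\mid k]-\hat E_0[y\mid k]-\hat\theta_m\big)^2+\frac{\hat\sigma_0^2(k)}{1-\pi(k)}+\frac{\hat\sigma_1^2(k)}{\pi(k)}\Big],\qquad\hat\sigma_a^2(k)=\hat E_a[y^2\mid k]-\hat E_a[y\mid k]^2 .$$ Here $\hat\theta_m$ is throughout one of the two estimates: the difference of the mean of $Y_j$ over the treated and its mean over the untreated units (an empty arm has mean $0$), or $\frac1m\sum_{j\le m}Y_jA_j-\frac1m\sum_{j\le m}Y_j(1-A_j)$. **Proposition.** For either choice of $\hat\theta_m$: 1. If $\hat T_m^{EM}\in\arg\min_{T\in\mathcal T}\widetilde V_m(T)$ for all $m$, almost surely, then $V(\hat T_m^{EM})\to V^*$ almost surely as $m\to\infty$. 2. If almost surely $\arg\min_{T\in\mathcal T}\widetilde V_m(T)\ne\emptyset$ for all $m$, then there are $\hat T_m^{EM}$ such that almost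 surely $\hat T_m^{EM}\in\arg\min_{T\in\mathcal T}\widetilde V_m(T)$ for all $m$, and such that each $\hat T_m^{EM}$ is measurable with respect to $\sigma(W_1,\dots,W_m)$ and any sigma-algebra on the set of trees, in particular the Borel sigma-algebra of $\rho$. 3. If $\mathcal T$ is closed with respect to $\rho$ in the set of all stratification trees of depth $L$, then almost surely $\arg\min_{T\in\mathcal T}\widetilde V_m(T)\neq\emptyset$ for all $m$. In particular, if $\mathcal T$ is countable and closed, then measurable empirical minimizers exist, and $V(\hat T_m^{EM})\to V^*$ almost surely for them. -/

import Mathlib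

open MeasureTheory ProbabilityTheory Filter Topology
open scoped ENNReal NNReal symmDiff

noncomputable section

namespace StratTrees

/-- The covariate space `∏ j, [b j, c j]` (the order on `Fin d → ℝ` is coordinatewise). -/
abbrev Cov {d : ℕ} (b c : Fin d → ℝ) : Type := Set.Icc b c

/-- One unit of the population: `(Y(1), Y(0), X)`. -/
abbrev Unit3 {d : ℕ} (b c : Fin d → ℝ) : Type := ℝ × ℝ × Cov b c

/-- One observation of an experiment: `(Y, A, X)`; the treatment `A = 1` is coded as `true`. -/
abbrev Obs {d : ℕ} (b c : Fin d → ℝ) : Type := ℝ × Bool × Cov b c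

/-! ### Trees -/

/-- The cuts of a binary tree of depth `L`: every inner node carries a coordinate `j` and a
threshold `γ`, and sends `x` down (`x j ≤ γ`) or up (`x j > γ`). -/
inductive CutTree (d : ℕ) : ℕ → Type
  | leaf : CutTree d 0
  | node {L : ℕ} (j : Fin d) (γ : ℝ) (D U : CutTree d L) : CutTree d (L + 1)

/-- The leaf that `x` reaches, as the list of its turns (`false` = down, `true` = up). -/
def CutTree.address {d : ℕ} : {L : ℕ} → CutTree d L → (Fin d → ℝ) → (Fin L → Bool)
  | _, .leaf, _ => Fin.elim0
  | _, .node j γ D U, x =>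
      if x j ≤ γ then Fin.cons false (D.address x) else Fin.cons true (U.address x)

/-- `S` forms a tree partition of depth `L` of the covariate space: its strata are the leaves of
a tree of depth `L` (some may be empty), with distinct leaves carrying distinct labels. -/
def IsTreePartition {d : ℕ} {b c : Fin d → ℝ} {L : ℕ} (S : Cov b c → Fin (2 ^ L)) : Prop :=
  ∃ (t : CutTree d L) (σ : (Fin L → Bool) ≃ Fin (2 ^ L)), ∀ x : Cov b c, S x = σ (t.address x.1)

/-- A stratification tree `T = (S, π)` of depth `L`. -/
structure StratTree {d : ℕ} (b c : Fin d → ℝ) (L : ℕ) where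
  S : Cov b c → Fin (2 ^ L)
  isTree : IsTreePartition S
  π : Fin (2 ^ L) → ℝ
  π_mem : ∀ k, π k ∈ Set.Icc (0 : ℝ) 1

/-! ### The population -/

/-- The potential outcome `Y(a)`. -/
def pot {d : ℕ} {b c : Fin d → ℝ} (a : Bool) (z : Unit3 b c) : ℝ := if a then z.1 else z.2.1

/-- The restrictions on the law `Q` of `(Y(1), Y(0), X)`; that `X` lies in the rectangle is part
of the type. `C` is the set of the continuous coordinates. An outcome is continuous if its law
has no atoms. -/
structure BoundedPopulation {d : ℕ} {b c : Fin d → ℝ} (Q : Measure (Unit3 b c)) (M : ℝ)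
    (C : Finset (Fin d)) : Prop where
  bounded : ∀ a : Bool, ∀ᵐ z ∂Q, pot a z ∈ Set.Icc (-M) M
  outcome_type : ∀ a : Bool,
    (∀ y : ℝ, Q (pot a ⁻¹' {y}) = 0) ∨ ∃ F : Finset ℝ, ∀ᵐ z ∂Q, pot a z ∈ F
  continuous_part : ∃ f : ({j // j ∈ C} → ℝ) → ℝ≥0∞,
    Measurable f ∧ (∃ B : ℝ≥0, ∀ x, f x ≤ B) ∧
    (∀ x ∈ Set.Icc (fun j : {j // j ∈ C} => b j) (fun j => c j), 0 < f x) ∧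
    Q.map (fun z (j : {j // j ∈ C}) => z.2.2.1 j) =
      (volume.restrict
        (Set.Icc (fun j : {j // j ∈ C} => b j) (fun j => c j))).withDensity f
  discrete_part : ∃ F : Finset ({j // j ∉ C} → ℝ),
    ∀ᵐ z ∂Q, (fun j : {j // j ∉ C} => z.2.2.1 j) ∈ F

section Population

variable {d : ℕ} {b c : Fin d → ℝ} {L : ℕ}

/-- The event `S(X) = k`. -/
def cell (T : StratTree b c L) (k : Fin (2 ^ L)) : Set (Unit3 b c) := {z | T.S z.2.2 = k}

/-- `E[g | S(X) = k]`; it is `0` if `P(S(X) = k) = 0`. -/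
def condMean (Q : Measure (Unit3 b c)) (T : StratTree b c L) (k : Fin (2 ^ L))
    (g : Unit3 b c → ℝ) : ℝ :=
  ∫ z, g z ∂(ProbabilityTheory.cond Q (cell T k))

/-- `σ_a²(k) = E[Y(a)² | S(X) = k] - E[Y(a) | S(X) = k]²`. -/
def condVar (Q : Measure (Unit3 b c)) (T : StratTree b c L) (k : Fin (2 ^ L)) (a : Bool) : ℝ :=
  condMean Q T k (fun z => pot a z ^ 2) - condMean Q T k (pot a) ^ 2

/-- The asymptotic variance `V(T)`. -/
def V (Q : Measure (Unit3 b c)) (T : StratTree b c L) : ℝ :=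
  ∑ k, Q.real (cell T k) *
    ((condMean Q T k (fun z => pot true z - pot false z)
        - ∫ z, (pot true z - pot false z) ∂Q) ^ 2
      + (condVar Q T k false / (1 - T.π k) + condVar Q T k true / T.π k))

/-- Every stratum `k` that is nonempty (as a subset of the covariate space) has a target
proportion in `[ν, 1 - ν]` and probability larger than `δ`. -/
def CellBounds (Q : Measure (Unit3 b c)) (ν δ : ℝ) (T : StratTree b c L) : Prop :=
  ∀ k, (T.S ⁻¹' {k}).Nonempty → T.π k ∈ Set.Icc ν (1 - ν) ∧ δ < Q.real (cell T k)

/-- The distance `ρ` of the labelled trees `T₁` and `T₂`: the sum of `∑ k, P_X(S₁⁻¹(k) ∆ S₂⁻¹(k))` and of the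
Euclidean distance of the vectors of target proportions. -/
def rho (Q : Measure (Unit3 b c)) (T₁ T₂ : StratTree b c L) : ℝ :=
  (∑ k, (Q.map (fun z => z.2.2)).real ((T₁.S ⁻¹' {k}) ∆ (T₂.S ⁻¹' {k})))
    + Real.sqrt (∑ k, (T₁.π k - T₂.π k) ^ 2)

/-- A class of trees is closed with respect to `ρ`. Trees at distance `0` are identified: `ρ` is
only a pseudometric if some covariates are discrete. A class of trees up to relabelling is
represented by the set of all their labelled versions, on which this is the quotient notion. -/
def IsClosedClass (Q : Measure (Unit3 b c)) (𝒯 : Set (StratTree b c L)) : Prop :=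
  ∀ T : StratTree b c L, (∀ ε > 0, ∃ T' ∈ 𝒯, rho Q T T' < ε) → ∃ T' ∈ 𝒯, rho Q T T' = 0

end Population

/-! ### The pilot experiment -/

/-- What is observed of the unit `z` under the treatment `a`: `(Y(a), a, X)`. -/
def observe {d : ℕ} {b c : Fin d → ℝ} (a : Bool) (z : Unit3 b c) : Obs b c := (pot a z, a, z.2.2)

/-- The units `Z 0, Z 1, …` are i.i.d. draws from `Q`, and the treatments `A 0, A 1, …` are
assigned by independent flips of a coin with probability `p`, independently of the units. -/
structure SimpleRandomAssignment {Ω : Type*} [MeasurableSpace Ω] (P : Measure Ω) {d : ℕ}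
    {b c : Fin d → ℝ} (Q : Measure (Unit3 b c)) (p : ℝ) (Z : ℕ → Ω → Unit3 b c)
    (A : ℕ → Ω → Bool) : Prop where
  measurable_Z : ∀ i, Measurable (Z i)
  measurable_A : ∀ i, Measurable (A i)
  law_Z : ∀ i, P.map (Z i) = Q
  indep_Z : iIndepFun Z P
  law_A : ∀ i, P (A i ⁻¹' {true}) = ENNReal.ofReal p
  indep_A : iIndepFun A P
  exogenous : IndepFun (fun ω i => A i ω) (fun ω i => Z i ω) P

/-- The pilot data of size `m`. -/
def pilot {Ω : Type*} {d : ℕ} {b c : Fin d → ℝ} (Z : ℕ → Ω → Unit3 b c) (A : ℕ → Ω → Bool)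
    (m : ℕ) (ω : Ω) : Fin m → Obs b c :=
  fun j => observe (A j ω) (Z j ω)

/-! ### The empirical criterion -/

section Empirical

variable {d : ℕ} {b c : Fin d → ℝ} {L m : ℕ}

/-- `m(k; T)`: the number of observations in stratum `k`. -/
def count (w : Fin m → Obs b c) (T : StratTree b c L) (k : Fin (2 ^ L)) : ℕ :=
  (Finset.univ.filter fun j => T.S (w j).2.2 = k).card

/-- `Ê[g(Y(a)) | S(X) = k]`: the mean of `g(Y)` over the `m_a(k; T)` observations in stratum `k`
that have treatment `a` (`0` if there are none). -/
def cellMean (w : Fin m → Obs b c) (T : StratTree b c L) (k : Fin (2 ^ L)) (a : Bool)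
    (g : ℝ → ℝ) : ℝ :=
  (∑ j with (w j).2.1 = a ∧ T.S (w j).2.2 = k, g (w j).1) /
    ((Finset.univ.filter fun j => (w j).2.1 = a ∧ T.S (w j).2.2 = k).card : ℝ)

/-- `σ̂_a²(k)`. -/
def cellVar (w : Fin m → Obs b c) (T : StratTree b c L) (k : Fin (2 ^ L)) (a : Bool) : ℝ :=
  cellMean w T k a (fun y => y ^ 2) - cellMean w T k a (fun y => y) ^ 2

/-- The overall difference in means, each arm normalized by its own number of observations. -/
def ateArmNormalized (w : Fin m → Obs b c) : ℝ :=
  (∑ j with (w j).2.1 = true, (w j).1) /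
      ((Finset.univ.filter fun j => (w j).2.1 = true).card : ℝ)
    - (∑ j with (w j).2.1 = false, (w j).1) /
      ((Finset.univ.filter fun j => (w j).2.1 = false).card : ℝ)

/-- The overall difference with both arms normalized by the sample size `m`. -/
def ateSampleNormalized (w : Fin m → Obs b c) : ℝ :=
  (∑ j with (w j).2.1 = true, (w j).1) / (m : ℝ)
    - (∑ j with (w j).2.1 = false, (w j).1) / (m : ℝ)

/-- The empirical variance `Ṽ(T)`, with `θhat` in the place of `Ê[Y(1) - Y(0)]`. -/
def empV (θhat : ℝ) (w : Fin m → Obs b c) (T : StratTree b c L) : ℝ :=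
  ∑ k, (count w T k : ℝ) / (m : ℝ) *
    (((cellMean w T k true (fun y => y) - cellMean w T k false (fun y => y)) - θhat) ^ 2
      + (cellVar w T k false / (1 - T.π k) + cellVar w T k true / T.π k))

/-- `T` is a minimizer of the empirical variance over the class `𝒯`. -/
def IsEmpMin (θhat : ℝ) (w : Fin m → Obs b c) (𝒯 : Set (StratTree b c L))
    (T : StratTree b c L) : Prop :=
  T ∈ 𝒯 ∧ ∀ T' ∈ 𝒯, empV θhat w T ≤ empV θhat w T'

end Empirical

end StratTrees

end

noncomputable section

namespace StratTrees

/-! ### Bracketing and a uniform law of large numbers -/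

/-! Consistency rests on uniform convergence of the criterion. A leaf of a tree is an intersection
of `L` half-spaces `{x j ≤ γ}` or complements of such, so the leaves of all trees of depth `L` form
a class with finite brackets of any precision (`bracketable_leafSets`), and the strong law holds
uniformly over them (`uniform_strong_law`). Hence the empirical moments of all strata of all trees
converge simultaneously, on one event of probability one. The contribution of a stratum is a fixed
function `cellCriterion` of six moments, of `θ` and of `π k`; the bounds on nonempty strata confine
the population moments to a compact box on which all denominators stay away from 0, so closeness of
moments gives closeness of criteria (`exists_forall_abs_empV_sub_le`). If `θhat` tends to `θ`, the
limiting criterion is `V` plus the square of the error of `θ`, a constant that does not depend on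
the tree (`centeredV_eq`). Thus even the estimate normalized by the sample size, whose limit is in
general not `E[Y(1) - Y(0)]`, does not affect the minimization.

A measurable choice over a countable class is the first minimizer in an enumeration.

For existence over a closed class, a minimizing sequence of trees has a subsequence whose labels
converge at every point to some `s`, with `s` almost everywhere the labelling of a tree
(`exists_subseq_stratTree`). Closedness yields `T'` in the class with `T'.S = s` almost everywhere,
but the empirical criterion sees labels at the data points, and `s` depends on the sample. So the
exceptional null set must be fixed beforehand. This is `label_eq_limit`: equality holds at every `x`
where small cubes with vertex `x` have positive mass and `T'` is locally constant. There the stratum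
of `x` keeps mass at least `δ` in the limit, hence contains a point `y` away from `x` in all
continuous coordinates; since leaves are boxes, the points between `x` and `y` share the label `s
x`, and some of them, arbitrarily near `x`, satisfy `T'.S = s`. -/

/-- For every `ε`, the sets of the class are enclosed by finitely many brackets of measure at
most `ε`. -/
def Bracketable {α : Type*} [MeasurableSpace α] (μ : Measure α) (𝓢 : Set (Set α)) : Prop :=
  ∀ ε : ℝ, 0 < ε → ∃ F : Set (Set α × Set α), F.Finite ∧
    (∀ B ∈ F, MeasurableSet B.1 ∧ MeasurableSet B.2 ∧ μ.real (B.2 \ B.1) ≤ ε) ∧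
    ∀ s ∈ 𝓢, ∃ B ∈ F, B.1 ⊆ s ∧ s ⊆ B.2

section Bracketing

variable {α β : Type*} [MeasurableSpace α] [MeasurableSpace β] {μ : Measure α}

lemma Bracketable.mono {𝓢 𝓣 : Set (Set α)} (h : Bracketable μ 𝓣) (hst : 𝓢 ⊆ 𝓣) :
    Bracketable μ 𝓢 := fun ε hε => by
  obtain ⟨F, hF, hm, hc⟩ := h ε hε
  exact ⟨F, hF, hm, fun s hs => hc s (hst hs)⟩

lemma bracketable_singleton {s : Set α} (hs : MeasurableSet s) : Bracketable μ {s} := fun ε hε =>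
  ⟨{(s, s)}, Set.finite_singleton _, by rintro _ rfl; simp [hs, hε.le],
    by rintro _ rfl; exact ⟨_, rfl, subset_rfl, subset_rfl⟩⟩

lemma Bracketable.compl {𝓢 : Set (Set α)} (h : Bracketable μ 𝓢) :
    Bracketable μ (compl '' 𝓢) := fun ε hε => by
  obtain ⟨F, hF, hm, hc⟩ := h ε hε
  refine ⟨(fun B => (B.2ᶜ, B.1ᶜ)) '' F, hF.image _, ?_, ?_⟩
  · rintro _ ⟨B, hB, rfl⟩
    obtain ⟨h1, h2, h3⟩ := hm B hB
    exact ⟨h2.compl, h1.compl, by simpa only [compl_sdiff_compl] using h3⟩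
  · rintro _ ⟨s, hs, rfl⟩
    obtain ⟨B, hB, h1, h2⟩ := hc s hs
    exact ⟨_, ⟨B, hB, rfl⟩, Set.compl_subset_compl.2 h2, Set.compl_subset_compl.2 h1⟩

lemma Bracketable.inter [IsFiniteMeasure μ] {𝓢 𝓣 : Set (Set α)} (h : Bracketable μ 𝓢)
    (h' : Bracketable μ 𝓣) : Bracketable μ (Set.image2 (· ∩ ·) 𝓢 𝓣) := fun ε hε => by
  obtain ⟨F, hF, hm, hc⟩ := h (ε / 2) (half_pos hε)
  obtain ⟨F', hF', hm', hc'⟩ := h' (ε / 2) (half_pos hε)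
  refine ⟨Set.image2 (fun B B' => (B.1 ∩ B'.1, B.2 ∩ B'.2)) F F', hF.image2 _ hF', ?_, ?_⟩
  · rintro _ ⟨B, hB, B', hB', rfl⟩
    obtain ⟨h1, h2, h3⟩ := hm B hB
    obtain ⟨h1', h2', h3'⟩ := hm' B' hB'
    refine ⟨h1.inter h1', h2.inter h2', ?_⟩
    have hsub : (B.2 ∩ B'.2) \ (B.1 ∩ B'.1) ⊆ (B.2 \ B.1) ∪ (B'.2 \ B'.1) := by
      intro x hx
      simp only [Set.mem_sdiff, Set.mem_inter_iff, Set.mem_union] at hx ⊢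
      tauto
    calc μ.real ((B.2 ∩ B'.2) \ (B.1 ∩ B'.1)) ≤ _ := measureReal_mono hsub
      _ ≤ _ := measureReal_union_le _ _
      _ ≤ ε := by linarith
  · rintro _ ⟨s, hs, t, ht, rfl⟩
    obtain ⟨B, hB, h1, h2⟩ := hc s hs
    obtain ⟨B', hB', h1', h2'⟩ := hc' t ht
    exact ⟨_, ⟨B, hB, B', hB', rfl⟩, Set.inter_subset_inter h1 h1', Set.inter_subset_inter h2 h2'⟩

lemma Bracketable.iUnion {ι : Type*} [Finite ι] {𝓢 : ι → Set (Set α)}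
    (h : ∀ i, Bracketable μ (𝓢 i)) : Bracketable μ (⋃ i, 𝓢 i) := fun ε hε => by
  choose F hF hm hc using fun i => h i ε hε
  refine ⟨⋃ i, F i, Set.finite_iUnion hF, ?_, ?_⟩
  · intro B hB
    obtain ⟨i, hi⟩ := Set.mem_iUnion.1 hB
    exact hm i B hi
  · intro s hs
    obtain ⟨i, hi⟩ := Set.mem_iUnion.1 hs
    obtain ⟨B, hB, h'⟩ := hc i s hi
    exact ⟨B, Set.mem_iUnion.2 ⟨i, hB⟩, h'⟩

lemma Bracketable.union {𝓢 𝓣 : Set (Set α)} (h : Bracketable μ 𝓢) (h' : Bracketable μ 𝓣) :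
    Bracketable μ (𝓢 ∪ 𝓣) := by
  rw [Set.union_eq_iUnion]
  exact Bracketable.iUnion fun b => by cases b <;> simpa

lemma Bracketable.preimage {f : α → β} (hf : Measurable f) {𝓢 : Set (Set β)}
    (h : Bracketable (μ.map f) 𝓢) : Bracketable μ (Set.preimage f '' 𝓢) := fun ε hε => by
  obtain ⟨F, hF, hm, hc⟩ := h ε hε
  refine ⟨(fun B => (f ⁻¹' B.1, f ⁻¹' B.2)) '' F, hF.image _, ?_, ?_⟩
  · rintro _ ⟨B, hB, rfl⟩
    obtain ⟨h1, h2, h3⟩ := hm B hB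
    refine ⟨hf h1, hf h2, ?_⟩
    rwa [map_measureReal_apply hf (h2.diff h1)] at h3
  · rintro _ ⟨s, hs, rfl⟩
    obtain ⟨B, hB, h1, h2⟩ := hc s hs
    exact ⟨_, ⟨B, hB, rfl⟩, Set.preimage_mono h1, Set.preimage_mono h2⟩

/-- The intervals shrink to the empty set as `η` decreases to 0, so continuity from above applies.
The point `t` is left out because it may be an atom. -/
lemma exists_punctured_interval_le (ν : Measure ℝ) [IsFiniteMeasure ν] (t : ℝ) {ε : ℝ}
    (hε : 0 < ε) :
    ∃ η > 0, ν.real (Set.Ioo t (t + η)) ≤ ε ∧ ν.real (Set.Ioo (t - η) t) ≤ ε := by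
  have key : ∀ s : ℝ → Set ℝ, (∀ r, MeasurableSet (s r)) → Monotone s → (⋂ r > 0, s r) = ∅ →
      ∀ᶠ r in 𝓝[>] (0 : ℝ), ν.real (s r) ≤ ε := by
    intro s hs hmono hempty
    have h := tendsto_measure_biInter_gt (μ := ν) (s := s) (a := 0)
      (fun r _ => (hs r).nullMeasurableSet) (fun i j _ hij => hmono hij) ⟨1, one_pos, by finiteness⟩
    rw [hempty, measure_empty] at h
    have h2 : Tendsto (fun r => ν.real (s r)) (𝓝[>] 0) (𝓝 0) := by
      simpa [Measure.real, Function.comp_def] using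
        (ENNReal.tendsto_toReal ENNReal.zero_ne_top).comp h
    exact (h2.eventually (gt_mem_nhds hε)).mono fun _ h => h.le
  have h1 := key (fun r => Set.Ioo t (t + r)) (fun r => measurableSet_Ioo)
    (fun r r' h => Set.Ioo_subset_Ioo_right (by linarith)) (by
      ext x
      simp only [Set.mem_iInter, Set.mem_Ioo, Set.mem_empty_iff_false, iff_false, not_forall]
      by_cases hx : t < x
      · exact ⟨x - t, by simpa using hx, by simp⟩
      · exact ⟨1, one_pos, fun h => hx h.1⟩)
  have h2 := key (fun r => Set.Ioo (t - r) t) (fun r => measurableSet_Ioo)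
    (fun r r' h => Set.Ioo_subset_Ioo_left (by linarith)) (by
      ext x
      simp only [Set.mem_iInter, Set.mem_Ioo, Set.mem_empty_iff_false, iff_false, not_forall]
      by_cases hx : x < t
      · exact ⟨t - x, by simpa using hx, by simp⟩
      · exact ⟨1, one_pos, fun h => hx h.2⟩)
  obtain ⟨η, h1, h2, h3⟩ := (h1.and (h2.and self_mem_nhdsWithin)).exists
  exact ⟨η, h3, h1, h2⟩

/-- The sublevel sets of a bounded function. -/
lemma bracketable_sublevel [IsFiniteMeasure μ] {f : α → ℝ} (hf : Measurable f) {lo hi : ℝ}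
    (hfm : ∀ x, f x ∈ Set.Icc lo hi) : Bracketable μ (Set.range fun γ : ℝ => {x | f x ≤ γ}) := by
  intro ε hε
  choose η hη h1 h2 using fun t => exists_punctured_interval_le (μ.map f) t hε
  obtain ⟨t, -, ht⟩ := isCompact_Icc (a := lo) (b := hi) |>.elim_nhds_subcover
    (fun t => Set.Ioo (t - η t) (t + η t))
    (fun t _ => Ioo_mem_nhds (by linarith [hη t]) (by linarith [hη t]))
  -- Each centre `s` gets three brackets, for thresholds below, at and above `s`; the case `γ = s`
  -- is separate because `s` may be an atom of the law of `f`. Thresholds outside `[lo, hi]` give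
  -- the empty set or everything.
  let F : Set (Set α × Set α) := {(∅, ∅), (Set.univ, Set.univ)} ∪
    ⋃ s ∈ t, {(f ⁻¹' Set.Iic (s - η s), f ⁻¹' Set.Iio s), (f ⁻¹' Set.Iic s, f ⁻¹' Set.Iic s),
      (f ⁻¹' Set.Iic s, f ⁻¹' Set.Iio (s + η s))}
  have hF : F.Finite := (Set.toFinite _).union (t.finite_toSet.biUnion fun _ _ => Set.toFinite _)
  refine ⟨F, hF, ?_, ?_⟩
  · intro B hB
    simp only [F, Set.mem_union, Set.mem_insert_iff, Set.mem_singleton_iff, Set.mem_iUnion] at hB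
    obtain (rfl | rfl) | ⟨s, -, rfl | rfl | rfl⟩ := hB
    · simp [hε.le]
    · simp [hε.le]
    · refine ⟨hf measurableSet_Iic, hf measurableSet_Iio, ?_⟩
      rw [← Set.preimage_sdiff, ← map_measureReal_apply hf (measurableSet_Iio.diff measurableSet_Iic)]
      refine le_trans (measureReal_mono ?_) (h2 s)
      rintro x ⟨h1, h2⟩
      exact ⟨not_le.1 h2, h1⟩
    · exact ⟨hf measurableSet_Iic, hf measurableSet_Iic, by simp [hε.le]⟩
    · refine ⟨hf measurableSet_Iic, hf measurableSet_Iio, ?_⟩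
      rw [← Set.preimage_sdiff, ← map_measureReal_apply hf (measurableSet_Iio.diff measurableSet_Iic)]
      refine le_trans (measureReal_mono ?_) (h1 s)
      rintro x ⟨h1, h2⟩
      exact ⟨not_le.1 h2, h1⟩
  · rintro _ ⟨γ, rfl⟩
    by_cases hlo : γ < lo
    · refine ⟨(∅, ∅), by simp [F], Set.empty_subset _, fun x hx => ?_⟩
      exact absurd (hx.trans_lt hlo) (not_lt.2 (hfm x).1)
    by_cases hhi : hi < γ
    · exact ⟨(Set.univ, Set.univ), by simp [F], fun x _ => (hfm x).2.trans hhi.le,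
        Set.subset_univ _⟩
    obtain ⟨s, hs, hγ⟩ := Set.mem_iUnion₂.1 (ht ⟨not_lt.1 hlo, not_lt.1 hhi⟩)
    have hsub : ∀ B, B ∈ ({(f ⁻¹' Set.Iic (s - η s), f ⁻¹' Set.Iio s),
        (f ⁻¹' Set.Iic s, f ⁻¹' Set.Iic s),
        (f ⁻¹' Set.Iic s, f ⁻¹' Set.Iio (s + η s))} : Set (Set α × Set α)) → B ∈ F :=
      fun B hB => Or.inr (Set.mem_iUnion₂.2 ⟨s, hs, hB⟩)
    obtain h | h | h := lt_trichotomy γ s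
    · exact ⟨_, hsub _ (Or.inl rfl), fun x hx => le_trans hx hγ.1.le,
        fun x hx => lt_of_le_of_lt hx h⟩
    · subst h
      exact ⟨_, hsub _ (Or.inr (Or.inl rfl)), fun x hx => hx, fun x hx => hx⟩
    · exact ⟨_, hsub _ (Or.inr (Or.inr rfl)), fun x hx => le_trans hx h.le,
        fun x hx => lt_of_le_of_lt hx hγ.2⟩

end Bracketing

/-! ### The strong law, uniformly over a bracketable class. -/

section UniformLaw

variable {Ω α : Type*} [MeasurableSpace Ω] {P : Measure Ω} [MeasurableSpace α] {μ : Measure α} {W : ℕ → Ω → α}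

lemma strong_law_comp (hW : ∀ i, Measurable (W i)) (hlaw : ∀ i, P.map (W i) = μ)
    (hind : Pairwise fun i j => IndepFun (W i) (W j) P) {g : α → ℝ} (hg : Measurable g)
    (hint : Integrable g μ) :
    ∀ᵐ ω ∂P, Tendsto (fun m : ℕ => (∑ i ∈ Finset.range m, g (W i ω)) / m) atTop
      (𝓝 (∫ x, g x ∂μ)) := by
  have h := strong_law_ae_real (μ := P) (fun i ω => g (W i ω))
    (by rw [← hlaw 0] at hint; exact hint.comp_measurable (hW 0))
    (fun i j hij => (hind hij).comp hg hg)
    (fun i => (IdentDistrib.mk (hW i).aemeasurable (hW 0).aemeasurable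
      (by rw [hlaw, hlaw])).comp hg)
  have he : ∫ x, g x ∂μ = P[fun ω => g (W 0 ω)] := by
    rw [← hlaw 0, integral_map (hW 0).aemeasurable hg.aestronglyMeasurable]
  rw [he]
  exact h

/-- A Glivenko–Cantelli theorem: the strong law of large numbers for the integrals of a bounded
function over the sets of a bracketable class, uniformly over the class. -/
theorem uniform_strong_law [IsProbabilityMeasure μ] (hW : ∀ i, Measurable (W i))
    (hlaw : ∀ i, P.map (W i) = μ) (hind : Pairwise fun i j => IndepFun (W i) (W j) P)
    {g : α → ℝ} (hg : Measurable g) {G : ℝ} (hG : ∀ᵐ x ∂μ, |g x| ≤ G) {𝓢 : Set (Set α)}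
    (hS : Bracketable μ 𝓢) :
    ∀ᵐ ω ∂P, ∀ ε > 0, ∀ᶠ m : ℕ in atTop, ∀ s ∈ 𝓢,
      |(∑ i ∈ Finset.range m, s.indicator g (W i ω)) / m - ∫ x in s, g x ∂μ| ≤ ε := by
  have hG0 : 0 ≤ G := by
    obtain ⟨x, hx⟩ := hG.exists
    exact (abs_nonneg _).trans hx
  have hint : Integrable g μ := .of_bound hg.aestronglyMeasurable G hG
  -- A sequence of tolerances with finitely many brackets each requires only countably many strong
  -- laws, hence a single null set for all `ε`.
  set e : ℕ → ℝ := fun n => 1 / ((n : ℝ) + 1) with he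
  have he0 : ∀ n, 0 < e n := fun n => by positivity
  choose F hF hFm hFc using fun n => hS (e n) (he0 n)
  have hfun : ∀ᵐ ω ∂P, ∀ i, |g (W i ω)| ≤ G := by
    refine ae_all_iff.2 fun i => ?_
    rw [← hlaw i] at hG
    exact ae_of_ae_map (hW i).aemeasurable hG
  have h1 : ∀ᵐ ω ∂P, ∀ n, ∀ B ∈ F n, Tendsto
      (fun m : ℕ => (∑ i ∈ Finset.range m, B.1.indicator g (W i ω)) / m) atTop
      (𝓝 (∫ x in B.1, g x ∂μ)) := by
    refine ae_all_iff.2 fun n => (ae_ball_iff (hF n).countable).2 fun B hB => ?_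
    have hm := (hFm n B hB).1
    rw [← integral_indicator hm]
    exact strong_law_comp hW hlaw hind (hg.indicator hm) (hint.indicator hm)
  have h2 : ∀ᵐ ω ∂P, ∀ n, ∀ B ∈ F n, Tendsto
      (fun m : ℕ => (∑ i ∈ Finset.range m, (B.2 \ B.1).indicator (1 : α → ℝ) (W i ω)) / m) atTop
      (𝓝 (μ.real (B.2 \ B.1))) := by
    refine ae_all_iff.2 fun n => (ae_ball_iff (hF n).countable).2 fun B hB => ?_
    have hm := (hFm n B hB).2.1.diff (hFm n B hB).1
    rw [← integral_indicator_one hm]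
    exact strong_law_comp hW hlaw hind (measurable_one.indicator hm)
      ((integrable_const (1 : ℝ)).indicator hm)
  filter_upwards [hfun, h1, h2] with ω hω h1 h2 ε hε
  -- The error is at most `e n` for the lower bracket, `2 * G * e n` for the empirical mass between
  -- the brackets, and `G * e n` for the population mass.
  obtain ⟨n, hn⟩ : ∃ n, e n * (1 + 3 * G) < ε := by
    obtain ⟨n, hn⟩ := exists_nat_one_div_lt (show 0 < ε / (1 + 3 * G) by positivity)
    exact ⟨n, by rwa [lt_div_iff₀ (by positivity)] at hn⟩
  have hall : ∀ᶠ m : ℕ in atTop, ∀ B ∈ F n,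
      |(∑ i ∈ Finset.range m, B.1.indicator g (W i ω)) / m - ∫ x in B.1, g x ∂μ| < e n ∧
      (∑ i ∈ Finset.range m, (B.2 \ B.1).indicator (1 : α → ℝ) (W i ω)) / m < 2 * e n := by
    refine (eventually_all_finite (hF n)).2 fun B hB => ?_
    refine ((Metric.tendsto_nhds.1 (h1 n B hB)) _ (he0 n)).and
      ((h2 n B hB).eventually (gt_mem_nhds ?_))
    linarith [(hFm n B hB).2.2, he0 n]
  filter_upwards [hall] with m hm s hs
  obtain ⟨B, hB, hB1, hB2⟩ := hFc n s hs
  obtain ⟨hm1, hm2⟩ := hm B hB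
  obtain ⟨hBm1, hBm2, hBε⟩ := hFm n B hB
  have hA : |(∑ i ∈ Finset.range m, s.indicator g (W i ω)) / m
      - (∑ i ∈ Finset.range m, B.1.indicator g (W i ω)) / m| ≤ G * (2 * e n) := by
    rw [← sub_div, ← Finset.sum_sub_distrib, abs_div, Nat.abs_cast]
    have hle : |∑ i ∈ Finset.range m, (s.indicator g (W i ω) - B.1.indicator g (W i ω))| ≤
        G * ∑ i ∈ Finset.range m, (B.2 \ B.1).indicator (1 : α → ℝ) (W i ω) := by
      rw [Finset.mul_sum]
      refine (Finset.abs_sum_le_sum_abs _ _).trans (Finset.sum_le_sum fun i _ => ?_)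
      by_cases hx1 : W i ω ∈ B.1
      · simp [hx1, hB1 hx1]
      · by_cases hxs : W i ω ∈ s
        · simpa [hx1, hxs, hB2 hxs] using hω i
        · simp only [Set.indicator_of_notMem hxs, Set.indicator_of_notMem hx1, sub_zero, abs_zero]
          exact mul_nonneg hG0 (Set.indicator_nonneg (by simp) _)
    calc _ ≤ (G * ∑ i ∈ Finset.range m, (B.2 \ B.1).indicator (1 : α → ℝ) (W i ω)) / m := by gcongr
      _ = G * ((∑ i ∈ Finset.range m, (B.2 \ B.1).indicator (1 : α → ℝ) (W i ω)) / m) :=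
        mul_div_assoc _ _ _
      _ ≤ _ := by gcongr
  have hC : |∫ x in s, g x ∂μ - ∫ x in B.1, g x ∂μ| ≤ G * e n := by
    rw [← setIntegral_sdiff hBm1 hint.integrableOn hB1, ← Real.norm_eq_abs]
    refine (norm_setIntegral_le_of_norm_le_const_ae' (C := G) (by finiteness) ?_).trans ?_
    · filter_upwards [hG] with x hx _ using hx
    · gcongr
      exact (measureReal_mono (Set.sdiff_subset_sdiff_left hB2)).trans hBε
  rw [abs_le] at hA hC ⊢
  rw [abs_lt] at hm1
  constructor <;> nlinarith
end UniformLaw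

/-- Two pairs are independent if their components are. -/
lemma indepFun_prodMk_prodMk {Ω α β : Type*} [MeasurableSpace Ω] {P : Measure Ω}
    [IsProbabilityMeasure P] [MeasurableSpace α] [MeasurableSpace β] {A A' : Ω → α} {Z Z' : Ω → β}
    (hA : Measurable A) (hA' : Measurable A') (hZ : Measurable Z) (hZ' : Measurable Z')
    (hAA : IndepFun A A' P) (hZZ : IndepFun Z Z' P)
    (h : IndepFun (fun ω => (A ω, A' ω)) (fun ω => (Z ω, Z' ω)) P) :
    IndepFun (fun ω => (A ω, Z ω)) (fun ω => (A' ω, Z' ω)) P := by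
  -- Rectangles form a generating π-system; on them the joint probability splits first between the
  -- `A`s and the `Z`s, then within each.
  have hgen : ∀ (f : Ω → α × β), MeasurableSpace.comap f inferInstance =
      MeasurableSpace.generateFrom (Set.preimage f '' (Set.image2 (· ×ˢ ·)
        {s : Set α | MeasurableSet s} {t : Set β | MeasurableSet t})) := fun f => by
    rw [← MeasurableSpace.comap_generateFrom, generateFrom_prod]
  refine IndepSets.indep (hA.prodMk hZ).comap_le (hA'.prodMk hZ').comap_le
    (isPiSystem_prod.comap _) (isPiSystem_prod.comap _) (hgen _) (hgen _) ?_
  rw [IndepSets_iff]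
  rintro _ _ ⟨_, ⟨s, hs, t, ht, rfl⟩, rfl⟩ ⟨_, ⟨s', hs', t', ht', rfl⟩, rfl⟩
  have e1 := (h.comp measurable_fst measurable_fst).measure_inter_preimage_eq_mul s t hs ht
  have e2 := (h.comp measurable_snd measurable_snd).measure_inter_preimage_eq_mul s' t' hs' ht'
  have e3 := h.measure_inter_preimage_eq_mul (s ×ˢ s') (t ×ˢ t') (hs.prod hs') (ht.prod ht')
  have e4 := hAA.measure_inter_preimage_eq_mul s s' hs hs'
  have e5 := hZZ.measure_inter_preimage_eq_mul t t' ht ht'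
  simp only [Function.comp_def, Set.mk_preimage_prod] at e1 e2 e3 e4 e5 ⊢
  rw [e1, e2, Set.inter_inter_inter_comm, e3, e4, e5]
  ring

/-! ### Cells of trees -/

section Cells

variable {d : ℕ} {b c : Fin d → ℝ} {L : ℕ}

lemma measurable_address : ∀ {L : ℕ} (t : CutTree d L),
    Measurable fun x : Cov b c => t.address x.1
  | _, .leaf => measurable_const
  | _, .node j γ D U => by
      simp only [CutTree.address]
      refine Measurable.ite (measurableSet_le ?_ measurable_const) ?_ ?_
      · exact (measurable_pi_apply j).comp measurable_subtype_coe
      · exact (Measurable.of_discrete (f := fun v : Fin _ → Bool =>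
          (Fin.cons false v : Fin (_ + 1) → Bool))).comp (measurable_address D)
      · exact (Measurable.of_discrete (f := fun v : Fin _ → Bool =>
          (Fin.cons true v : Fin (_ + 1) → Bool))).comp (measurable_address U)

lemma StratTree.measurable_S (T : StratTree b c L) : Measurable T.S := by
  obtain ⟨t, σ, h⟩ := T.isTree
  rw [show T.S = fun x => σ (t.address x.1) from funext h]
  exact (Measurable.of_discrete (f := σ)).comp (measurable_address t)

lemma measurableSet_cell (T : StratTree b c L) (k : Fin (2 ^ L)) : MeasurableSet (cell T k) :=
  (T.measurable_S.comp (measurable_snd.comp measurable_snd)) (measurableSet_singleton k)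

/-- The leaves of all trees of depth `L`. -/
def leafSets (b c : Fin d → ℝ) (L : ℕ) : Set (Set (Cov b c)) :=
  {s | ∃ (t : CutTree d L) (a : Fin L → Bool), s = {x | t.address x.1 = a}}

/-- By induction on the depth: a leaf of a node is a half-space or its complement, intersected with
a leaf of one of the two subtrees. -/
lemma bracketable_leafSets (μ : Measure (Cov b c)) [IsFiniteMeasure μ] :
    ∀ L, Bracketable μ (leafSets b c L)
  | 0 => (bracketable_singleton MeasurableSet.univ).mono <| by
      rintro _ ⟨t, a, rfl⟩
      rw [Set.mem_singleton_iff, Set.eq_univ_iff_forall]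
      exact fun x => Subsingleton.elim _ _
  | L + 1 => by
      have hH : Bracketable μ (⋃ j : Fin d, Set.range fun γ : ℝ => {x : Cov b c | x.1 j ≤ γ}) :=
        Bracketable.iUnion fun j => bracketable_sublevel
          ((measurable_pi_apply j).comp measurable_subtype_coe)
          (fun x => ⟨x.2.1 j, x.2.2 j⟩)
      refine ((hH.union hH.compl).inter (bracketable_leafSets μ L)).mono ?_
      rintro _ ⟨t, a, rfl⟩
      cases t with
      | node j γ D U =>
        have hmem : {x : Cov b c | x.1 j ≤ γ} ∈
            ⋃ j : Fin d, Set.range fun γ : ℝ => {x : Cov b c | x.1 j ≤ γ} :=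
          Set.mem_iUnion.2 ⟨j, γ, rfl⟩
        obtain ⟨e, v, rfl⟩ : ∃ (e : Bool) (v : Fin L → Bool), a = Fin.cons e v :=
          ⟨a 0, Fin.tail a, (Fin.cons_self_tail a).symm⟩
        cases e with
        | false =>
          refine ⟨_, Or.inl hmem, {x | D.address x.1 = v}, ⟨D, _, rfl⟩, ?_⟩
          ext x
          by_cases hx : x.1 j ≤ γ <;>
            simp [CutTree.address, hx, Fin.cons_inj]
        | true =>
          refine ⟨_, Or.inr ⟨_, hmem, rfl⟩, {x | U.address x.1 = v}, ⟨U, _, rfl⟩, ?_⟩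
          ext x
          by_cases hx : x.1 j ≤ γ <;>
            simp [CutTree.address, hx, Fin.cons_inj]

lemma StratTree.preimage_S_mem_leafSets (T : StratTree b c L) (k : Fin (2 ^ L)) :
    T.S ⁻¹' {k} ∈ leafSets b c L := by
  obtain ⟨t, σ, h⟩ := T.isTree
  refine ⟨t, σ.symm k, ?_⟩
  ext x
  simp [h, Equiv.eq_symm_apply]

end Cells

/-! ### Measurable selection of a minimizer -/

section Selection

variable {d : ℕ} {b c : Fin d → ℝ} {L m : ℕ}

lemma measurable_pot (a : Bool) : Measurable (pot a : Unit3 b c → ℝ) := by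
  cases a
  · exact measurable_fst.comp measurable_snd
  · exact measurable_fst

lemma measurable_sum_arm (a : Bool) {q : Cov b c → Prop} [DecidablePred q]
    (hq : MeasurableSet {x | q x}) {g : ℝ → ℝ} (hg : Measurable g) :
    Measurable fun w : Fin m → Obs b c =>
      ∑ j, if (w j).2.1 = a ∧ q (w j).2.2 then g (w j).1 else 0 := by
  refine Finset.measurable_sum _ fun j _ => Measurable.ite ?_ ?_ measurable_const
  · have h1 : Measurable fun w : Fin m → Obs b c => (w j).2.1 :=
      measurable_fst.comp (measurable_snd.comp (measurable_pi_apply j))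
    have h2 : Measurable fun w : Fin m → Obs b c => (w j).2.2 :=
      measurable_snd.comp (measurable_snd.comp (measurable_pi_apply j))
    exact (h1 (measurableSet_singleton a)).inter (h2 hq)
  · exact hg.comp (measurable_fst.comp (measurable_pi_apply j))

lemma measurable_cellMean (T : StratTree b c L) (k : Fin (2 ^ L)) (a : Bool) {g : ℝ → ℝ}
    (hg : Measurable g) : Measurable fun w : Fin m → Obs b c => cellMean w T k a g := by
  have hs : MeasurableSet {x | T.S x = k} := T.measurable_S (measurableSet_singleton k)
  simp only [cellMean, Finset.card_filter, Finset.sum_filter, Nat.cast_sum, Nat.cast_ite,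
    Nat.cast_one, Nat.cast_zero]
  exact (measurable_sum_arm a hs hg).div (measurable_sum_arm a hs measurable_const)

lemma measurable_count (T : StratTree b c L) (k : Fin (2 ^ L)) :
    Measurable fun w : Fin m → Obs b c => (count w T k : ℝ) := by
  simp only [count, Finset.card_filter, Nat.cast_sum, Nat.cast_ite, Nat.cast_one, Nat.cast_zero]
  refine Finset.measurable_sum _ fun j _ => Measurable.ite ?_ measurable_const measurable_const
  have h2 : Measurable fun w : Fin m → Obs b c => (w j).2.2 :=
    measurable_snd.comp (measurable_snd.comp (measurable_pi_apply j))
  exact h2 (T.measurable_S (measurableSet_singleton k))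

lemma measurable_empV {θhat : (Fin m → Obs b c) → ℝ} (hθ : Measurable θhat)
    (T : StratTree b c L) : Measurable fun w => empV (θhat w) w T := by
  have hid := fun k a => measurable_cellMean (m := m) T k a (measurable_id (α := ℝ))
  have hsq := fun k a => measurable_cellMean (m := m) T k a
    ((measurable_id (α := ℝ)).pow_const 2)
  have hvar : ∀ k a, Measurable fun w : Fin m → Obs b c => cellVar w T k a :=
    fun k a => (hsq k a).sub ((hid k a).pow_const 2)
  refine Finset.measurable_sum _ fun k _ => ((measurable_count T k).div_const _).mul ?_
  exact ((((hid k true).sub (hid k false)).sub hθ).pow_const 2).add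
    (((hvar k false).div_const _).add ((hvar k true).div_const _))

lemma measurable_sum_obs (a : Bool) {g : ℝ → ℝ} (hg : Measurable g) :
    Measurable fun w : Fin m → Obs b c => ∑ j, if (w j).2.1 = a then g (w j).1 else 0 := by
  simpa using measurable_sum_arm (m := m) (q := fun _ : Cov b c => True) a MeasurableSet.univ hg

lemma measurable_ateArmNormalized :
    Measurable (ateArmNormalized : (Fin m → Obs b c) → ℝ) := by
  unfold ateArmNormalized
  simp only [Finset.card_filter, Finset.sum_filter, Nat.cast_sum, Nat.cast_ite,
    Nat.cast_one, Nat.cast_zero]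
  exact ((measurable_sum_obs true measurable_id).div (measurable_sum_obs true measurable_const)).sub
    ((measurable_sum_obs false measurable_id).div (measurable_sum_obs false measurable_const))

lemma measurable_ateSampleNormalized :
    Measurable (ateSampleNormalized : (Fin m → Obs b c) → ℝ) := by
  unfold ateSampleNormalized
  simp only [Finset.sum_filter]
  exact ((measurable_sum_obs true measurable_id).div_const _).sub
    ((measurable_sum_obs false measurable_id).div_const _)

/-- Over a countable class, the first minimizer in an enumeration is measurable for every
sigma-algebra on the trees. -/
lemma exists_measurable_minimizer {𝒯 : Set (StratTree b c L)} (hne : 𝒯.Nonempty)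
    (hcount : 𝒯.Countable) {θhat : (Fin m → Obs b c) → ℝ} (hθ : Measurable θhat) :
    ∃ τ : (Fin m → Obs b c) → StratTree b c L, (∀ B, MeasurableSet (τ ⁻¹' B)) ∧
      ∀ w, (∃ T, IsEmpMin (θhat w) w 𝒯 T) → IsEmpMin (θhat w) w 𝒯 (τ w) := by
  classical
  obtain ⟨f, rfl⟩ := hcount.exists_eq_range hne
  have hm : ∀ n, MeasurableSet {w | IsEmpMin (θhat w) w (Set.range f) (f n)} := fun n => by
    have : {w | IsEmpMin (θhat w) w (Set.range f) (f n)} =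
        ⋂ i, {w | empV (θhat w) w (f n) ≤ empV (θhat w) w (f i)} := by
      ext w
      simp [IsEmpMin]
    rw [this]
    exact .iInter fun i => measurableSet_le (measurable_empV hθ _) (measurable_empV hθ _)
  -- The second alternative makes the search total: without a minimizer it stops at 0.
  let q : (Fin m → Obs b c) → ℕ → Prop := fun w n =>
    IsEmpMin (θhat w) w (Set.range f) (f n) ∨ ¬ ∃ n, IsEmpMin (θhat w) w (Set.range f) (f n)
  have hq : ∀ w, ∃ n, q w n := fun w => by
    by_cases h : ∃ n, IsEmpMin (θhat w) w (Set.range f) (f n)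
    · exact h.imp fun n hn => Or.inl hn
    · exact ⟨0, Or.inr h⟩
  have hex : MeasurableSet {w | ¬ ∃ n, IsEmpMin (θhat w) w (Set.range f) (f n)} := by
    have : {w | ¬ ∃ n, IsEmpMin (θhat w) w (Set.range f) (f n)} =
        (⋃ n, {w | IsEmpMin (θhat w) w (Set.range f) (f n)})ᶜ := by
      ext w
      simp
    rw [this]
    exact (MeasurableSet.iUnion hm).compl
  have hfind := measurable_find hq fun n => (hm n).union hex
  -- The choice factors through `ℕ`, all of whose subsets are measurable; hence no restriction on
  -- `B`.
  refine ⟨fun w => f (Nat.find (hq w)), fun B => hfind (.of_discrete (s := f ⁻¹' B)), ?_⟩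
  rintro w ⟨T, hT⟩
  obtain ⟨n, rfl⟩ := hT.1
  exact (Nat.find_spec (hq w)).resolve_right fun h => h ⟨n, hT⟩

end Selection

/-! ### The criterion as a function of cell moments -/

section Moments

variable {d : ℕ} {b c : Fin d → ℝ} {L m : ℕ}

/-- The sum of `Y ^ i` over the observations in stratum `k` with treatment `a`, divided by the
size of the whole sample. -/
def mom (w : Fin m → Obs b c) (T : StratTree b c L) (k : Fin (2 ^ L)) (a : Bool) (i : ℕ) : ℝ :=
  (∑ j with (w j).2.1 = a ∧ T.S (w j).2.2 = k, (w j).1 ^ i) / m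

/-- The probability of the treatment `a`. -/
def armProb (p : ℝ) (a : Bool) : ℝ := if a then p else 1 - p

/-- The limit of `mom`. -/
def popMom (Q : Measure (Unit3 b c)) (p : ℝ) (T : StratTree b c L) (k : Fin (2 ^ L)) (a : Bool)
    (i : ℕ) : ℝ :=
  armProb p a * ∫ z in cell T k, pot a z ^ i ∂Q

/-- The contribution of a stratum to the criterion in terms of its moments. -/
def cellCriterion (u : Bool → Fin 3 → ℝ) (θ q : ℝ) : ℝ :=
  (u true 0 + u false 0) *
    ((u true 1 / u true 0 - u false 1 / u false 0 - θ) ^ 2 +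
      ((u false 2 / u false 0 - (u false 1 / u false 0) ^ 2) / (1 - q) +
        (u true 2 / u true 0 - (u true 1 / u true 0) ^ 2) / q))

/-- The asymptotic variance with `θ` in the place of `E[Y(1) - Y(0)]`. -/
def centeredV (Q : Measure (Unit3 b c)) (θ : ℝ) (T : StratTree b c L) : ℝ :=
  ∑ k, Q.real (cell T k) *
    ((condMean Q T k (fun z => pot true z - pot false z) - θ) ^ 2
      + (condVar Q T k false / (1 - T.π k) + condVar Q T k true / T.π k))

lemma mom_zero (w : Fin m → Obs b c) (T : StratTree b c L) (k : Fin (2 ^ L)) (a : Bool) :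
    mom w T k a 0 =
      ((Finset.univ.filter fun j => (w j).2.1 = a ∧ T.S (w j).2.2 = k).card : ℝ) / m := by
  simp [mom]

lemma cellMean_pow (hm : m ≠ 0) (w : Fin m → Obs b c) (T : StratTree b c L) (k : Fin (2 ^ L))
    (a : Bool) (i : ℕ) : cellMean w T k a (fun y => y ^ i) = mom w T k a i / mom w T k a 0 := by
  rw [mom_zero, mom, div_div_div_cancel_right₀ (Nat.cast_ne_zero.2 hm), cellMean]

lemma count_div (w : Fin m → Obs b c) (T : StratTree b c L) (k : Fin (2 ^ L)) :
    (count w T k : ℝ) / m = mom w T k true 0 + mom w T k false 0 := by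
  rw [mom_zero, mom_zero, ← add_div, count,
    ← Finset.card_filter_add_card_filter_not (s := Finset.univ.filter fun j => T.S (w j).2.2 = k)
      (fun j => (w j).2.1 = true), Finset.filter_filter, Finset.filter_filter]
  push_cast
  simp [and_comm]

lemma empV_eq_sum (hm : m ≠ 0) (θ : ℝ) (w : Fin m → Obs b c) (T : StratTree b c L) :
    empV θ w T = ∑ k, cellCriterion (fun a i => mom w T k a i) θ (T.π k) := by
  have h1 : ∀ k a, cellMean w T k a (fun y => y) = mom w T k a 1 / mom w T k a 0 := fun k a => by
    simpa using cellMean_pow hm w T k a 1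
  refine Finset.sum_congr rfl fun k _ => ?_
  simp [count_div, cellVar, h1, cellMean_pow hm, cellCriterion]

lemma mom_of_empty (w : Fin m → Obs b c) (T : StratTree b c L) {k : Fin (2 ^ L)}
    (hk : ¬ (T.S ⁻¹' {k}).Nonempty) (a : Bool) (i : ℕ) : mom w T k a i = 0 := by
  have : ∀ j, T.S (w j).2.2 ≠ k := fun j hj => hk ⟨_, hj⟩
  simp [mom, this]

lemma cell_of_empty (T : StratTree b c L) {k : Fin (2 ^ L)}
    (hk : ¬ (T.S ⁻¹' {k}).Nonempty) : cell T k = ∅ :=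
  Set.eq_empty_of_forall_notMem fun _ hz => hk ⟨_, hz⟩

section Population

variable {Q : Measure (Unit3 b c)}

lemma condMean_eq (T : StratTree b c L) (k : Fin (2 ^ L)) (g : Unit3 b c → ℝ) :
    condMean Q T k g = (∫ z in cell T k, g z ∂Q) / Q.real (cell T k) := by
  rw [condMean, ProbabilityTheory.cond, integral_smul_measure, ENNReal.toReal_inv, smul_eq_mul,
    div_eq_inv_mul, Measure.real]

lemma ae_abs_pot_pow_le {M : ℝ} (hM : ∀ a : Bool, ∀ᵐ z ∂Q, pot a z ∈ Set.Icc (-M) M)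
    (a : Bool) {i : ℕ} (hi : i ≤ 2) : ∀ᵐ z ∂Q, |pot a z ^ i| ≤ (1 + |M|) ^ 2 := by
  filter_upwards [hM a] with z hz
  rw [abs_pow]
  have h1 : |pot a z| ≤ 1 + |M| := (abs_le.2 hz).trans (by linarith [le_abs_self M])
  calc |pot a z| ^ i ≤ (1 + |M|) ^ i := by gcongr
    _ ≤ (1 + |M|) ^ 2 := pow_le_pow_right₀ (by linarith [abs_nonneg M]) hi

variable [IsProbabilityMeasure Q]

lemma integrable_pot_pow {M : ℝ} (hM : ∀ a : Bool, ∀ᵐ z ∂Q, pot a z ∈ Set.Icc (-M) M)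
    (a : Bool) {i : ℕ} (hi : i ≤ 2) : Integrable (fun z => pot a z ^ i) Q :=
  .of_bound ((measurable_pot a).pow_const i).aestronglyMeasurable _ (ae_abs_pot_pow_le hM a hi)

lemma integrable_pot {M : ℝ} (hM : ∀ a : Bool, ∀ᵐ z ∂Q, pot a z ∈ Set.Icc (-M) M) (a : Bool) :
    Integrable (pot a) Q := by
  simpa using integrable_pot_pow hM a (i := 1) (by norm_num)

/-- The treatment probabilities cancel in the ratios of moments, and in the leading factor they add
up to 1, so `p` disappears. -/
lemma centeredV_summand_eq {M : ℝ} (hM : ∀ a : Bool, ∀ᵐ z ∂Q, pot a z ∈ Set.Icc (-M) M)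
    {p : ℝ} (hp : p ∈ Set.Ioo (0 : ℝ) 1) (θ : ℝ) (T : StratTree b c L) (k : Fin (2 ^ L)) :
    Q.real (cell T k) *
      ((condMean Q T k (fun z => pot true z - pot false z) - θ) ^ 2
        + (condVar Q T k false / (1 - T.π k) + condVar Q T k true / T.π k)) =
    cellCriterion (fun a i => popMom Q p T k a i) θ (T.π k) := by
  have hdiv : ∀ a (i : ℕ), popMom Q p T k a i / popMom Q p T k a 0 =
      (∫ z in cell T k, pot a z ^ i ∂Q) / Q.real (cell T k) := fun a i => by
    have hpa : armProb p a ≠ 0 := by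
      cases a <;> simp [armProb, hp.1.ne', (sub_pos.2 hp.2).ne']
    rw [popMom, popMom, mul_div_mul_left _ _ hpa]
    simp
  have hsum : popMom Q p T k true 0 + popMom Q p T k false 0 = Q.real (cell T k) := by
    simp [popMom, armProb]
    ring
  simp only [cellCriterion, Fin.val_zero, Fin.val_one, Fin.val_two, hsum, hdiv, condVar,
    condMean_eq, integral_sub (integrable_pot hM true).integrableOn
      (integrable_pot hM false).integrableOn, sub_div, pow_one]

omit [IsProbabilityMeasure Q] in
lemma sum_cell_setIntegral (T : StratTree b c L) {g : Unit3 b c → ℝ} (hg : Integrable g Q) :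
    ∑ k, ∫ z in cell T k, g z ∂Q = ∫ z, g z ∂Q := by
  rw [← integral_iUnion_fintype (measurableSet_cell T) ?_ fun _ => hg.integrableOn]
  · have : (⋃ k, cell T k) = Set.univ := Set.eq_univ_of_forall fun z =>
      Set.mem_iUnion.2 ⟨T.S z.2.2, rfl⟩
    rw [this, setIntegral_univ]
  · intro k k' h
    exact Set.disjoint_left.2 fun z hz hz' => h (hz.symm.trans hz')

/-- The conditional effects average to `E[Y(1) - Y(0)]` over the strata, so the cross term vanishes
when the square is expanded around this mean. -/
lemma centeredV_eq {M : ℝ} (hM : ∀ a : Bool, ∀ᵐ z ∂Q, pot a z ∈ Set.Icc (-M) M) (θ : ℝ)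
    (T : StratTree b c L) :
    centeredV Q θ T = V Q T + ((∫ z, (pot true z - pot false z) ∂Q) - θ) ^ 2 := by
  have hint : Integrable (fun z => pot true z - pot false z) Q :=
    (integrable_pot hM true).sub (integrable_pot hM false)
  set e := ∫ z, (pot true z - pot false z) ∂Q with he
  have h1 : ∑ k, Q.real (cell T k) = 1 := by
    simpa using sum_cell_setIntegral T (integrable_const (μ := Q) (1 : ℝ))
  have h2 : ∑ k, Q.real (cell T k) * condMean Q T k (fun z => pot true z - pot false z) = e := by
    rw [he, ← sum_cell_setIntegral T hint]
    refine Finset.sum_congr rfl fun k _ => ?_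
    rw [condMean_eq]
    by_cases h0 : Q.real (cell T k) = 0
    · rw [h0, zero_mul, setIntegral_measure_zero _ ((measureReal_eq_zero_iff).1 h0)]
    · exact mul_div_cancel₀ _ h0
  have h3 : ∀ k, Q.real (cell T k) *
      ((condMean Q T k (fun z => pot true z - pot false z) - θ) ^ 2
        + (condVar Q T k false / (1 - T.π k) + condVar Q T k true / T.π k)) =
      Q.real (cell T k) *
      ((condMean Q T k (fun z => pot true z - pot false z) - e) ^ 2
        + (condVar Q T k false / (1 - T.π k) + condVar Q T k true / T.π k)) +
      (2 * (e - θ) * (Q.real (cell T k) * condMean Q T k (fun z => pot true z - pot false z)) +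
        ((e - θ) ^ 2 - 2 * (e - θ) * e) * Q.real (cell T k)) := fun k => by ring
  rw [centeredV, Finset.sum_congr rfl fun k _ => h3 k, Finset.sum_add_distrib,
    Finset.sum_add_distrib, ← Finset.mul_sum, ← Finset.mul_sum, h1, h2, V]
  ring

end Population

/-- A compact set that contains the moments of all admissible cells. -/
def momentBox (p δ B θ ν : ℝ) : Set ((Bool → Fin 3 → ℝ) × ℝ × ℝ) :=
  (Set.univ.pi fun a => Set.univ.pi fun i =>
    Set.Icc (if i = 0 then armProb p a * δ else -B) B) ×ˢ ({θ} ×ˢ Set.Icc ν (1 - ν))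

lemma isCompact_momentBox (p δ B θ ν : ℝ) : IsCompact (momentBox p δ B θ ν) :=
  (isCompact_univ_pi fun _ => isCompact_univ_pi fun _ => isCompact_Icc).prod
    (isCompact_singleton.prod isCompact_Icc)

lemma armProb_mem {p : ℝ} (hp : p ∈ Set.Ioo (0 : ℝ) 1) (a : Bool) :
    armProb p a ∈ Set.Ioo (0 : ℝ) 1 := by
  cases a
  · simpa [armProb] using ⟨hp.2, hp.1⟩
  · simpa [armProb] using hp

lemma continuousAt_cellCriterion {p δ B θ ν : ℝ} (hp : p ∈ Set.Ioo (0 : ℝ) 1) (hδ : 0 < δ)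
    (hν : 0 < ν) {x : (Bool → Fin 3 → ℝ) × ℝ × ℝ} (hx : x ∈ momentBox p δ B θ ν) :
    ContinuousAt (fun x : (Bool → Fin 3 → ℝ) × ℝ × ℝ => cellCriterion x.1 x.2.1 x.2.2) x := by
  obtain ⟨h1, -, h3⟩ := hx
  have h0 : ∀ a, x.1 a 0 ≠ 0 := fun a => by
    have := (h1 a trivial 0 trivial).1
    rw [if_pos rfl] at this
    exact ((mul_pos (armProb_mem hp a).1 hδ).trans_le this).ne'
  have h4 : x.2.2 ≠ 0 := (hν.trans_le h3.1).ne'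
  have h5 : 1 - x.2.2 ≠ 0 := by have := h3.2; intro h; linarith
  have hc : ∀ a i, ContinuousAt (fun x : (Bool → Fin 3 → ℝ) × ℝ × ℝ => x.1 a i) x := fun a i => by
    fun_prop
  have hd : ∀ a i, ContinuousAt (fun x : (Bool → Fin 3 → ℝ) × ℝ × ℝ => x.1 a i / x.1 a 0) x :=
    fun a i => (hc a i).div (hc a 0) (h0 a)
  unfold cellCriterion
  refine ((hc _ _).add (hc _ _)).mul (((((hd _ _).sub (hd _ _)).sub ?_).pow 2).add
    ((((hd _ _).sub ((hd _ _).pow 2)).div ?_ h5).add (((hd _ _).sub ((hd _ _).pow 2)).div ?_ h4)))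
  all_goals fun_prop

lemma popMom_mem_momentBox {Q : Measure (Unit3 b c)} [IsProbabilityMeasure Q] {M : ℝ}
    (hM : ∀ a : Bool, ∀ᵐ z ∂Q, pot a z ∈ Set.Icc (-M) M) {p ν δ : ℝ}
    (hp : p ∈ Set.Ioo (0 : ℝ) 1) (θ : ℝ) {T : StratTree b c L} (hT : CellBounds Q ν δ T)
    {k : Fin (2 ^ L)} (hk : (T.S ⁻¹' {k}).Nonempty) :
    (((fun a i => popMom Q p T k a i), θ, T.π k) : (Bool → Fin 3 → ℝ) × ℝ × ℝ) ∈
      momentBox p δ ((1 + |M|) ^ 2) θ ν := by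
  refine ⟨fun a _ i _ => ?_, rfl, (hT k hk).1⟩
  have hpa := armProb_mem hp a
  have hle : |popMom Q p T k a i| ≤ (1 + |M|) ^ 2 := by
    rw [popMom, abs_mul, abs_of_pos hpa.1]
    have h : |∫ z in cell T k, pot a z ^ (i : ℕ) ∂Q| ≤ (1 + |M|) ^ 2 := by
      have := norm_setIntegral_le_of_norm_le_const_ae' (μ := Q) (s := cell T k)
        (f := fun z => pot a z ^ (i : ℕ)) (C := (1 + |M|) ^ 2) (by finiteness) (by
          filter_upwards [ae_abs_pot_pow_le hM a (Nat.lt_succ_iff.1 i.2)] with z hz _ using hz)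
      refine this.trans (mul_le_of_le_one_right (by positivity) measureReal_le_one)
    nlinarith [hpa.1, hpa.2, abs_nonneg (∫ z in cell T k, pot a z ^ (i : ℕ) ∂Q)]
  refine ⟨?_, (abs_le.1 hle).2⟩
  split_ifs with hi
  · subst hi
    have : popMom Q p T k a 0 = armProb p a * Q.real (cell T k) := by simp [popMom]
    change _ ≤ popMom Q p T k a 0
    rw [this]
    exact mul_le_mul_of_nonneg_left (hT k hk).2.le hpa.1.le
  · exact (abs_le.1 hle).1

/-- Closeness of all the moments entails closeness of the criteria, uniformly over the trees that
satisfy the bounds on the cells. -/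
lemma exists_forall_abs_empV_sub_le {Q : Measure (Unit3 b c)} [IsProbabilityMeasure Q] {M : ℝ}
    (hM : ∀ a : Bool, ∀ᵐ z ∂Q, pot a z ∈ Set.Icc (-M) M) {p ν δ : ℝ}
    (hp : p ∈ Set.Ioo (0 : ℝ) 1) (hν : 0 < ν) (hδ : 0 < δ) (L : ℕ) (θ : ℝ) {ε : ℝ} (hε : 0 < ε) :
    ∃ η > 0, ∀ (m : ℕ), m ≠ 0 → ∀ (w : Fin m → Obs b c) (θ' : ℝ) (T : StratTree b c L),
      CellBounds Q ν δ T → |θ' - θ| ≤ η →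
      (∀ k a, ∀ i : Fin 3, |mom w T k a i - popMom Q p T k a i| ≤ η) →
      |empV θ' w T - centeredV Q θ T| ≤ ε := by
  have hε' : 0 < ε / 2 ^ L := by positivity
  -- Uniform continuity here compares a point of the compact box with any nearby point, so the
  -- empirical moments need not lie in the box.
  have hunif := (isCompact_momentBox p δ ((1 + |M|) ^ 2) θ ν).uniformContinuousAt_of_continuousAt
    (fun x => cellCriterion x.1 x.2.1 x.2.2)
    (fun x hx => continuousAt_cellCriterion hp hδ hν hx) (Metric.dist_mem_uniformity hε')
  obtain ⟨η, hη, h⟩ := Metric.mem_uniformity_dist.1 hunif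
  refine ⟨η / 2, half_pos hη, fun m hm w θ' T hT hθ hmom => ?_⟩
  rw [empV_eq_sum hm, centeredV, Finset.sum_congr rfl fun k _ => centeredV_summand_eq hM hp θ T k,
    ← Finset.sum_sub_distrib]
  have hk : ∀ k, |cellCriterion (fun a i => mom w T k a i) θ' (T.π k) -
      cellCriterion (fun a i => popMom Q p T k a i) θ (T.π k)| ≤ ε / 2 ^ L := fun k => by
    by_cases hk : (T.S ⁻¹' {k}).Nonempty
    · have := @h (((fun a i => popMom Q p T k a i), θ, T.π k) : (Bool → Fin 3 → ℝ) × ℝ × ℝ)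
        (((fun a i => mom w T k a i), θ', T.π k) : (Bool → Fin 3 → ℝ) × ℝ × ℝ) ?_
        (popMom_mem_momentBox hM hp θ hT hk)
      · rw [abs_sub_comm]
        exact (show _ < _ from this).le
      · refine lt_of_le_of_lt ?_ (half_lt_self hη)
        rw [dist_comm, Prod.dist_eq, Prod.dist_eq]
        refine max_le ((dist_pi_le_iff (by positivity)).2 fun a =>
          (dist_pi_le_iff (by positivity)).2 fun i => hmom k a i) (max_le hθ ?_)
        rw [dist_self]
        positivity
    -- For an empty stratum `π k` is unconstrained, but both contributions are 0.
    · simp [cellCriterion, mom_of_empty w T hk, popMom, cell_of_empty T hk, hε'.le]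
  calc _ ≤ ∑ k, _ := Finset.abs_sum_le_sum_abs _ _
    _ ≤ ∑ _k : Fin (2 ^ L), ε / 2 ^ L := Finset.sum_le_sum fun k _ => hk k
    _ = ε := by
      simp
      field_simp

lemma bddBelow_V {Q : Measure (Unit3 b c)} [IsProbabilityMeasure Q] {M : ℝ}
    (hM : ∀ a : Bool, ∀ᵐ z ∂Q, pot a z ∈ Set.Icc (-M) M) {ν δ : ℝ}
    (hν : 0 < ν) (hδ : 0 < δ) {𝒯 : Set (StratTree b c L)}
    (h𝒯 : ∀ T ∈ 𝒯, CellBounds Q ν δ T) : BddBelow (V Q '' 𝒯) := by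
  set θ := ∫ z, (pot true z - pot false z) ∂Q
  -- `V` does not involve `p`, so any value in the unit interval serves to write it in terms of
  -- moments.
  have hp : (1 / 2 : ℝ) ∈ Set.Ioo (0 : ℝ) 1 := by norm_num
  obtain ⟨l, hl⟩ := (isCompact_momentBox (1 / 2) δ ((1 + |M|) ^ 2) θ ν).bddBelow_image
    (fun x hx => (continuousAt_cellCriterion hp hδ hν hx).continuousWithinAt)
  refine ⟨∑ _k : Fin (2 ^ L), min l 0, ?_⟩
  rintro _ ⟨T, hT, rfl⟩
  have : V Q T = ∑ k, cellCriterion (fun a i => popMom Q (1 / 2) T k a i) θ (T.π k) :=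
    Finset.sum_congr rfl fun k _ => centeredV_summand_eq hM hp θ T k
  rw [this]
  refine Finset.sum_le_sum fun k _ => ?_
  by_cases hk : (T.S ⁻¹' {k}).Nonempty
  · exact (min_le_left _ _).trans
      (hl ⟨_, popMom_mem_momentBox hM hp θ (h𝒯 T hT) hk, rfl⟩)
  · simp [cellCriterion, popMom, cell_of_empty T hk]

end Moments

/-! ### Consistency of empirical minimizers -/

section Consistency

variable {Ω : Type*} [MeasurableSpace Ω] {P : Measure Ω} [IsProbabilityMeasure P]
  {d : ℕ} {b c : Fin d → ℝ} {L : ℕ} {Q : Measure (Unit3 b c)} {p : ℝ}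
  {Z : ℕ → Ω → Unit3 b c} {A : ℕ → Ω → Bool}

/-- The power `Y ^ i` of the outcome on the units with treatment `a`. -/
def armPow (a : Bool) (i : ℕ) (u : Bool × Unit3 b c) : ℝ := if u.1 = a then pot a u.2 ^ i else 0

lemma measurable_armPow (a : Bool) (i : ℕ) :
    Measurable (armPow a i : Bool × Unit3 b c → ℝ) :=
  Measurable.ite (measurable_fst (measurableSet_singleton a))
    (((measurable_pot a).comp measurable_snd).pow_const i) measurable_const

omit [MeasurableSpace Ω] in
lemma sum_pilot_eq_sum_armPow (a : Bool) (i m : ℕ) (ω : Ω) (s : Set (Cov b c))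
    [DecidablePred (· ∈ s)] :
    ∑ j with (pilot Z A m ω j).2.1 = a ∧ (pilot Z A m ω j).2.2 ∈ s, (pilot Z A m ω j).1 ^ i =
      ∑ j ∈ Finset.range m, ((fun u : Bool × Unit3 b c => u.2.2.2) ⁻¹' s).indicator (armPow a i)
        (A j ω, Z j ω) := by
  rw [Finset.sum_filter, ← Fin.sum_univ_eq_sum_range
    (fun j => ((fun u : Bool × Unit3 b c => u.2.2.2) ⁻¹' s).indicator (armPow a i)
        (A j ω, Z j ω)) m]
  refine Finset.sum_congr rfl fun j _ => ?_
  by_cases hs : (Z j ω).2.2 ∈ s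
  · rw [Set.indicator_of_mem (by exact hs)]
    by_cases ha : A j ω = a
    · simp [pilot, observe, armPow, ha, hs]
    · simp [pilot, observe, armPow, ha]
  · rw [Set.indicator_of_notMem (by exact hs)]
    simp [pilot, observe, hs]

/-! ### Laws of large numbers for the pilot data. -/

namespace SimpleRandomAssignment

lemma map_treatment (h : SimpleRandomAssignment P Q p Z A) (i : ℕ) :
    P.map (A i) = P.map (A 0) := by
  have := Measure.isProbabilityMeasure_map (μ := P) (h.measurable_A i).aemeasurable
  have := Measure.isProbabilityMeasure_map (μ := P) (h.measurable_A 0).aemeasurable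
  have htrue : ∀ j, P.map (A j) {true} = ENNReal.ofReal p := fun j => by
    rw [Measure.map_apply (h.measurable_A j) (measurableSet_singleton _), h.law_A]
  refine Measure.ext_of_singleton fun a => ?_
  cases a
  · have hc : ({false} : Set Bool) = {true}ᶜ := by ext a; cases a <;> simp
    rw [hc, prob_compl_eq_one_sub (measurableSet_singleton _),
      prob_compl_eq_one_sub (measurableSet_singleton _), htrue, htrue]
  · rw [htrue, htrue]

lemma map_pair (h : SimpleRandomAssignment P Q p Z A) (i : ℕ) :
    P.map (fun ω => (A i ω, Z i ω)) = (P.map (A 0)).prod Q := by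
  have hind : IndepFun (A i) (Z i) P :=
    h.exogenous.comp (measurable_pi_apply i) (measurable_pi_apply i)
  rw [(indepFun_iff_map_prod_eq_prod_map_map (h.measurable_A i).aemeasurable
    (h.measurable_Z i).aemeasurable).1 hind, h.law_Z, h.map_treatment]

omit [IsProbabilityMeasure P] in
lemma measurable_pair (h : SimpleRandomAssignment P Q p Z A) (i : ℕ) :
    Measurable fun ω => (A i ω, Z i ω) := (h.measurable_A i).prodMk (h.measurable_Z i)

lemma indepFun_pair (h : SimpleRandomAssignment P Q p Z A) :
    Pairwise fun i j => IndepFun (fun ω => (A i ω, Z i ω)) (fun ω => (A j ω, Z j ω)) P :=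
  fun i j hij => indepFun_prodMk_prodMk (h.measurable_A i) (h.measurable_A j) (h.measurable_Z i)
    (h.measurable_Z j) (h.indep_A.indepFun hij) (h.indep_Z.indepFun hij)
    (h.exogenous.comp ((measurable_pi_apply i).prodMk (measurable_pi_apply j))
      ((measurable_pi_apply i).prodMk (measurable_pi_apply j)))

lemma isProbabilityMeasure (h : SimpleRandomAssignment P Q p Z A) : IsProbabilityMeasure Q :=
  h.law_Z 0 ▸ Measure.isProbabilityMeasure_map (h.measurable_Z 0).aemeasurable

lemma real_treatment (h : SimpleRandomAssignment P Q p Z A) (hp : p ∈ Set.Ioo (0 : ℝ) 1)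
    (a : Bool) : (P.map (A 0)).real {a} = armProb p a := by
  have := Measure.isProbabilityMeasure_map (μ := P) (h.measurable_A 0).aemeasurable
  have htrue : (P.map (A 0)).real {true} = p := by
    rw [Measure.real, Measure.map_apply (h.measurable_A 0) (measurableSet_singleton _), h.law_A,
      ENNReal.toReal_ofReal hp.1.le]
  cases a
  · have hc : ({false} : Set Bool) = {true}ᶜ := by ext a; cases a <;> simp
    rw [hc, probReal_compl_eq_one_sub (measurableSet_singleton _), htrue]
    simp [armProb]
  · simpa [armProb] using htrue

/-- Under the product law the integrand is a function of the treatment times a function of the unit,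
so the integral factorizes. -/
lemma setIntegral_armPow (h : SimpleRandomAssignment P Q p Z A) (hp : p ∈ Set.Ioo (0 : ℝ) 1)
    (a : Bool) (i : ℕ) {s : Set (Cov b c)} (hs : MeasurableSet s) :
    ∫ u in (fun u : Bool × Unit3 b c => u.2.2.2) ⁻¹' s, armPow a i u ∂((P.map (A 0)).prod Q) =
      armProb p a * ∫ z in (fun z : Unit3 b c => z.2.2) ⁻¹' s, pot a z ^ i ∂Q := by
  have := h.isProbabilityMeasure
  have := Measure.isProbabilityMeasure_map (μ := P) (h.measurable_A 0).aemeasurable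
  have hm1 : Measurable fun z : Unit3 b c => z.2.2 := measurable_snd.comp measurable_snd
  have hm2 : Measurable fun u : Bool × Unit3 b c => u.2.2.2 := hm1.comp measurable_snd
  rw [← integral_indicator (hm2 hs), ← integral_indicator (hm1 hs),
    ← h.real_treatment hp a, ← integral_indicator_one (measurableSet_singleton a),
    ← integral_prod_mul]
  refine integral_congr_ae (Eventually.of_forall fun u => ?_)
  by_cases hu : u.2.2.2 ∈ s <;> by_cases ha : u.1 = a <;>
    simp [Set.indicator, hu, ha, armPow]

lemma ae_abs_armPow_le (h : SimpleRandomAssignment P Q p Z A) {M : ℝ}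
    (hM : ∀ a : Bool, ∀ᵐ z ∂Q, pot a z ∈ Set.Icc (-M) M) (a : Bool) {i : ℕ} (hi : i ≤ 2) :
    ∀ᵐ u ∂((P.map (A 0)).prod Q), |armPow a i u| ≤ (1 + |M|) ^ 2 := by
  have := h.isProbabilityMeasure
  have := Measure.isProbabilityMeasure_map (μ := P) (h.measurable_A 0).aemeasurable
  filter_upwards [Measure.quasiMeasurePreserving_snd.ae (ae_abs_pot_pow_le hM a hi)] with u hu
  rw [armPow]
  split_ifs
  · exact hu
  · simp only [abs_zero]
    positivity

/-- Uniform convergence of the moments of the cells of all trees. -/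
lemma ae_eventually_abs_mom_sub_le (h : SimpleRandomAssignment P Q p Z A)
    (hp : p ∈ Set.Ioo (0 : ℝ) 1) {M : ℝ}
    (hM : ∀ a : Bool, ∀ᵐ z ∂Q, pot a z ∈ Set.Icc (-M) M) :
    ∀ᵐ ω ∂P, ∀ ε > 0, ∀ᶠ m : ℕ in atTop, ∀ (T : StratTree b c L) k a, ∀ i : Fin 3,
      |mom (pilot Z A m ω) T k a i - popMom Q p T k a i| ≤ ε := by
  classical
  have := h.isProbabilityMeasure
  have := Measure.isProbabilityMeasure_map (μ := P) (h.measurable_A 0).aemeasurable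
  have hm1 : Measurable fun u : Bool × Unit3 b c => u.2.2.2 :=
    measurable_snd.comp (measurable_snd.comp measurable_snd)
  have key : ∀ᵐ ω ∂P, ∀ (a : Bool) (i : Fin 3), ∀ ε > 0, ∀ᶠ m : ℕ in atTop,
      ∀ s ∈ Set.preimage (fun u : Bool × Unit3 b c => u.2.2.2) '' leafSets b c L,
      |(∑ j ∈ Finset.range m, s.indicator (armPow a i) (A j ω, Z j ω)) / m -
        ∫ u in s, armPow a i u ∂((P.map (A 0)).prod Q)| ≤ ε := by
    refine ae_all_iff.2 fun a => ae_all_iff.2 fun i => ?_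
    have := Measure.isProbabilityMeasure_map (μ := (P.map (A 0)).prod Q) hm1.aemeasurable
    exact uniform_strong_law h.measurable_pair h.map_pair h.indepFun_pair (measurable_armPow a i)
      (h.ae_abs_armPow_le hM a (Nat.lt_succ_iff.1 i.2))
      ((bracketable_leafSets _ L).preimage hm1)
  filter_upwards [key] with ω hω ε hε
  filter_upwards [eventually_all.2 fun a => eventually_all.2 fun i => hω a i ε hε]
    with m hm T k a i
  have hs : MeasurableSet (T.S ⁻¹' {k}) := T.measurable_S (measurableSet_singleton k)
  have := hm a i _ ⟨_, T.preimage_S_mem_leafSets k, rfl⟩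
  rw [h.setIntegral_armPow hp a i hs, ← sum_pilot_eq_sum_armPow] at this
  rw [mom, popMom]
  convert this <;> rfl

/-- The overall mean of `Y ^ i` on an arm. -/
lemma ae_tendsto_arm (h : SimpleRandomAssignment P Q p Z A) (hp : p ∈ Set.Ioo (0 : ℝ) 1) {M : ℝ}
    (hM : ∀ a : Bool, ∀ᵐ z ∂Q, pot a z ∈ Set.Icc (-M) M) (a : Bool) {i : ℕ} (hi : i ≤ 2) :
    ∀ᵐ ω ∂P, Tendsto (fun m : ℕ => (∑ j with (pilot Z A m ω j).2.1 = a,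
      (pilot Z A m ω j).1 ^ i) / (m : ℝ)) atTop (𝓝 (armProb p a * ∫ z, pot a z ^ i ∂Q)) := by
  classical
  have := h.isProbabilityMeasure
  have := Measure.isProbabilityMeasure_map (μ := P) (h.measurable_A 0).aemeasurable
  have h1 := strong_law_comp h.measurable_pair h.map_pair h.indepFun_pair (measurable_armPow a i)
    (.of_bound (measurable_armPow a i).aestronglyMeasurable _ (h.ae_abs_armPow_le hM a hi))
  have h2 := h.setIntegral_armPow hp a i MeasurableSet.univ
  simp only [Set.preimage_univ, setIntegral_univ] at h2
  rw [h2] at h1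
  filter_upwards [h1] with ω hω
  refine hω.congr fun m => ?_
  have := sum_pilot_eq_sum_armPow (Z := Z) (A := A) a i m ω Set.univ
  simp only [Set.mem_univ, and_true, Set.preimage_univ, Set.indicator_univ] at this
  rw [this]

lemma ae_tendsto_ateArmNormalized (h : SimpleRandomAssignment P Q p Z A)
    (hp : p ∈ Set.Ioo (0 : ℝ) 1) {M : ℝ}
    (hM : ∀ a : Bool, ∀ᵐ z ∂Q, pot a z ∈ Set.Icc (-M) M) :
    ∀ᵐ ω ∂P, Tendsto (fun m => ateArmNormalized (pilot Z A m ω)) atTop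
      (𝓝 ((∫ z, pot true z ∂Q) - ∫ z, pot false z ∂Q)) := by
  have := h.isProbabilityMeasure
  have hmean : ∀ᵐ ω ∂P, ∀ a, Tendsto (fun m : ℕ => (∑ j with (pilot Z A m ω j).2.1 = a,
      (pilot Z A m ω j).1) / ((Finset.univ.filter fun j => (pilot Z A m ω j).2.1 = a).card : ℝ))
      atTop (𝓝 (∫ z, pot a z ∂Q)) := by
    refine ae_all_iff.2 fun a => ?_
    filter_upwards [h.ae_tendsto_arm hp hM a (i := 0) (by norm_num),
      h.ae_tendsto_arm hp hM a (i := 1) (by norm_num)] with ω h0 h1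
    have hpa := (armProb_mem hp a).1.ne'
    simp only [pow_zero, pow_one, integral_const, probReal_univ, smul_eq_mul, mul_one,
      Finset.sum_const, nsmul_eq_mul] at h0 h1
    have hdiv := h1.div h0 hpa
    rw [mul_div_cancel_left₀ _ hpa] at hdiv
    refine hdiv.congr' ?_
    filter_upwards [eventually_ne_atTop 0] with m hm
    exact div_div_div_cancel_right₀ (Nat.cast_ne_zero.2 hm) _ _
  filter_upwards [hmean] with ω hω using (hω true).sub (hω false)

/-- The arms keep the weights `p` and `1 - p`, so the limit is in general not the average effect;
`ae_tendsto_V` accepts any constant. -/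
lemma ae_tendsto_ateSampleNormalized (h : SimpleRandomAssignment P Q p Z A)
    (hp : p ∈ Set.Ioo (0 : ℝ) 1) {M : ℝ}
    (hM : ∀ a : Bool, ∀ᵐ z ∂Q, pot a z ∈ Set.Icc (-M) M) :
    ∀ᵐ ω ∂P, Tendsto (fun m => ateSampleNormalized (pilot Z A m ω)) atTop
      (𝓝 (p * (∫ z, pot true z ∂Q) - (1 - p) * ∫ z, pot false z ∂Q)) := by
  filter_upwards [h.ae_tendsto_arm hp hM true (i := 1) (by norm_num),
    h.ae_tendsto_arm hp hM false (i := 1) (by norm_num)] with ω h1 h0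
  simpa [ateSampleNormalized, armProb] using h1.sub h0

/-- If `θhat` converges to any constant, then empirical minimizers are consistent: the error in
the limit changes the criterion of all trees by the same constant. -/
lemma ae_tendsto_V (h : SimpleRandomAssignment P Q p Z A)
    (hp : p ∈ Set.Ioo (0 : ℝ) 1) {M : ℝ}
    (hM : ∀ a : Bool, ∀ᵐ z ∂Q, pot a z ∈ Set.Icc (-M) M) {ν δ : ℝ} (hν : 0 < ν) (hδ : 0 < δ)
    {𝒯 : Set (StratTree b c L)} (hne : 𝒯.Nonempty) (hcell : ∀ T ∈ 𝒯, CellBounds Q ν δ T)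
    {θhat : (m : ℕ) → (Fin m → Obs b c) → ℝ} {θ : ℝ}
    (hθ : ∀ᵐ ω ∂P, Tendsto (fun m => θhat m (pilot Z A m ω)) atTop (𝓝 θ))
    {That : ℕ → Ω → StratTree b c L}
    (hmin : ∀ᵐ ω ∂P, ∀ m, IsEmpMin (θhat m (pilot Z A m ω)) (pilot Z A m ω) 𝒯 (That m ω)) :
    ∀ᵐ ω ∂P, Tendsto (fun m => V Q (That m ω)) atTop (𝓝 (sInf (V Q '' 𝒯))) := by
  have := h.isProbabilityMeasure
  filter_upwards [hmin, hθ, h.ae_eventually_abs_mom_sub_le hp hM (L := L)] with ω hmin hθ hmom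
  rw [Metric.tendsto_atTop']
  intro ε hε
  obtain ⟨η, hη, hclose⟩ := exists_forall_abs_empV_sub_le (b := b) (c := c) hM hp hν hδ L θ
    (show 0 < ε / 4 by positivity)
  obtain ⟨_, ⟨T₀, hT₀, rfl⟩, hlt⟩ := exists_lt_of_csInf_lt (hne.image (V Q))
    (show sInf (V Q '' 𝒯) < sInf (V Q '' 𝒯) + ε / 4 by linarith)
  have hev : ∀ᶠ m in atTop, dist (V Q (That m ω)) (sInf (V Q '' 𝒯)) < ε := by
    filter_upwards [hmom η hη, Metric.tendsto_nhds.1 hθ η hη, eventually_ne_atTop 0]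
      with m h1 h2 h3
    -- Uniformity over the class is essential: the bound is applied to the random tree `That m ω`.
    -- The constant from `centeredV_eq` cancels in the comparison with `T₀`.
    have hA : ∀ T ∈ 𝒯, |empV (θhat m (pilot Z A m ω)) (pilot Z A m ω) T
        - centeredV Q θ T| ≤ ε / 4 := fun T hT =>
      hclose m h3 _ _ T (hcell T hT) (le_of_lt h2) (h1 T)
    have h4 := abs_le.1 (hA _ (hmin m).1)
    have h5 := abs_le.1 (hA _ hT₀)
    have h6 := (hmin m).2 _ hT₀
    rw [centeredV_eq hM] at h4 h5
    have h7 : sInf (V Q '' 𝒯) ≤ V Q (That m ω) :=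
      csInf_le (bddBelow_V hM hν hδ hcell) ⟨_, (hmin m).1, rfl⟩
    rw [Real.dist_eq, abs_lt]
    constructor <;> linarith [h4.1, h4.2, h5.1, h5.2]
  obtain ⟨N, hN⟩ := eventually_atTop.1 hev
  exact ⟨N, fun n hn => hN n hn.le⟩

end SimpleRandomAssignment

end Consistency

/-! ### Corners of positive measure -/

/-- For an absolutely continuous measure, almost every point `x` has the property that all small
cubes with `x` on their boundary, or inside, have positive measure. -/
lemma ae_forall_eventually_measure_closedBall_ne_zero {ι : Type*} [Fintype ι]
    (κ : Measure (ι → ℝ)) [IsFiniteMeasure κ] (h : κ ≪ volume) :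
    ∀ᵐ x ∂κ, ∀ s : ι → ℝ, ‖s‖ ≤ 1 →
      ∀ᶠ η in 𝓝[>] (0 : ℝ), κ (Metric.closedBall (x + η • s) η) ≠ 0 := by
  -- Lebesgue differentiation along off-centre cubes: each contains `x` because `‖s‖ ≤ 1`, so the
  -- ratio of `κ` to volume tends to the density at `x`, which is positive `κ`-almost everywhere.
  filter_upwards [h.ae_le ((IsUnifLocDoublingMeasure.vitaliFamily
    (volume : Measure (ι → ℝ)) 1).ae_tendsto_rnDeriv κ), Measure.rnDeriv_pos h] with x hx hpos s hs
  have hmem : ∀ᶠ η in 𝓝[>] (0 : ℝ), x ∈ Metric.closedBall (x + η • s) (1 * η) := by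
    filter_upwards [self_mem_nhdsWithin] with η hη
    rw [Metric.mem_closedBall, dist_eq_norm, sub_add_cancel_left, norm_neg, norm_smul, one_mul,
      Real.norm_of_nonneg (le_of_lt hη)]
    exact mul_le_of_le_one_right (le_of_lt hη) hs
  have hlim := hx.comp (IsUnifLocDoublingMeasure.tendsto_closedBall_filterAt
    (volume : Measure (ι → ℝ)) (fun η : ℝ => x + η • s) (fun η => η) tendsto_id hmem)
  filter_upwards [hlim.eventually_ne hpos.ne'] with η hη h0
  exact hη (by simp [h0])

section Limits

variable {d : ℕ} {b c : Fin d → ℝ} {L : ℕ} {μ : Measure (Cov b c)} {C : Finset (Fin d)}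

/-- Every cube that has `x` as a vertex, inside the slice on which the coordinates outside `C`
are those of `x`, has positive measure. -/
def HasMassiveCorners (μ : Measure (Cov b c)) (C : Finset (Fin d)) (x : Cov b c) : Prop :=
  ∀ y : Fin d → ℝ, (∀ j ∈ C, y j ≠ x.1 j) → ∀ r > 0,
    μ {z | (∀ j ∉ C, z.1 j = x.1 j) ∧
      ∀ j ∈ C, z.1 j ∈ Set.uIcc (x.1 j) (y j) ∧ |z.1 j - x.1 j| ≤ r} ≠ 0

/-- The discrete coordinates take finitely many values almost surely. On each of these slices the
continuous coordinates have an absolutely continuous law, to which differentiation along cubes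
applies. -/
lemma ae_hasMassiveCorners [IsFiniteMeasure μ]
    (hC : μ.map (fun x (j : {j // j ∈ C}) => x.1 j) ≪ volume)
    (hD : ∃ F : Finset ({j // j ∉ C} → ℝ), ∀ᵐ x ∂μ, (fun j : {j // j ∉ C} => x.1 j) ∈ F) :
    ∀ᵐ x ∂μ, HasMassiveCorners μ C x := by
  obtain ⟨F, hF⟩ := hD
  have hmC : Measurable fun (x : Cov b c) (j : {j // j ∈ C}) => x.1 j :=
    measurable_pi_lambda _ fun j => (measurable_pi_apply _).comp measurable_subtype_coe
  have hmD : Measurable fun (x : Cov b c) (j : {j // j ∉ C}) => x.1 j :=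
    measurable_pi_lambda _ fun j => (measurable_pi_apply _).comp measurable_subtype_coe
  have hslice : ∀ v ∈ F, ∀ᵐ x ∂μ, (fun j : {j // j ∉ C} => x.1 j) = v →
      HasMassiveCorners μ C x := fun v _ => by
    have hmv : MeasurableSet {x : Cov b c | (fun j : {j // j ∉ C} => x.1 j) = v} :=
      hmD (measurableSet_singleton v)
    have h := ae_of_ae_map hmC.aemeasurable (ae_forall_eventually_measure_closedBall_ne_zero
      ((μ.restrict {x | (fun j : {j // j ∉ C} => x.1 j) = v}).map
        (fun x (j : {j // j ∈ C}) => x.1 j))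
      ((Measure.restrict_le_self.absolutelyContinuous.map hmC).trans hC))
    rw [ae_restrict_iff' hmv] at h
    filter_upwards [h] with x hx hxv y hy r hr h0
    -- The signs point from `x` towards `y`: the cube of radius `η` around `x + η • s` has `x` as a
    -- vertex and side `2 * η`, so for small `η` it fits between `x` and `y`.
    let s : {j // j ∈ C} → ℝ := fun j => if x.1 j < y j then 1 else -1
    have hs : ‖s‖ ≤ 1 := (pi_norm_le_iff_of_nonneg zero_le_one).2 fun j => by
      by_cases h : x.1 j < y j <;> simp [s, h]
    have hsmall : ∀ᶠ η in 𝓝[>] (0 : ℝ), ∀ j : {j // j ∈ C}, 2 * η ≤ |y j - x.1 j| ∧ 2 * η ≤ r := by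
      refine eventually_all.2 fun j => nhdsWithin_le_nhds ?_
      have hpos : 0 < |y j - x.1 j| := abs_pos.2 (sub_ne_zero.2 (hy j j.2))
      have ht : Tendsto (fun η : ℝ => 2 * η) (𝓝 0) (𝓝 0) := by
        simpa using (continuous_const_mul (2 : ℝ)).tendsto 0
      exact ((ht.eventually (gt_mem_nhds hpos)).and (ht.eventually (gt_mem_nhds hr))).mono
        fun η h => ⟨h.1.le, h.2.le⟩
    obtain ⟨η, h1, h2, h3⟩ := ((hx hxv s hs).and (hsmall.and self_mem_nhdsWithin)).exists
    have hη : 0 < η := h3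
    refine h1 ?_
    rw [Measure.map_apply hmC Metric.isClosed_closedBall.measurableSet,
      Measure.restrict_apply (hmC Metric.isClosed_closedBall.measurableSet)]
    refine measure_mono_null ?_ h0
    rintro z ⟨hz, hzv⟩
    refine ⟨fun j hj => ?_, fun j hj => ?_⟩
    · have := congrFun ((show _ = v from hzv).trans hxv.symm) ⟨j, hj⟩
      exact this
    · have hd := (dist_pi_le_iff hη.le).1 (Metric.mem_closedBall.1 hz) ⟨j, hj⟩
      obtain ⟨h4, h5⟩ := h2 ⟨j, hj⟩
      simp only [Pi.add_apply, Pi.smul_apply, smul_eq_mul, Real.dist_eq, s] at hd h4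
      rw [abs_le] at hd
      rw [Set.mem_uIcc, abs_le]
      by_cases hlt : x.1 j < y j
      · rw [if_pos hlt] at hd
        rw [abs_of_pos (sub_pos.2 hlt)] at h4
        exact ⟨Or.inl ⟨by linarith, by linarith⟩, by linarith, by linarith⟩
      · rw [if_neg hlt] at hd
        rw [abs_of_nonpos (sub_nonpos.2 (not_lt.1 hlt))] at h4
        exact ⟨Or.inr ⟨by linarith, by linarith⟩, by linarith, by linarith⟩
  filter_upwards [hF, (ae_ball_iff F.countable_toSet).2 hslice] with x hx h
  exact h _ hx rfl

lemma ae_coord_ne (hC : μ.map (fun x (j : {j // j ∈ C}) => x.1 j) ≪ volume) {j : Fin d}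
    (hj : j ∈ C) (t : ℝ) : ∀ᵐ x ∂μ, x.1 j ≠ t := by
  have hmC : Measurable fun (x : Cov b c) (j : {j // j ∈ C}) => x.1 j :=
    measurable_pi_lambda _ fun j => (measurable_pi_apply _).comp measurable_subtype_coe
  have h : ∀ᵐ v : {j // j ∈ C} → ℝ ∂volume, v ⟨j, hj⟩ ≠ t := by
    rw [volume_pi, ae_iff]
    simpa using Measure.pi_hyperplane (fun _ : {j // j ∈ C} => (volume : Measure ℝ)) ⟨j, hj⟩ t
  exact ae_of_ae_map hmC.aemeasurable (hC.ae_le h)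

/-! ### Limits of trees -/

/-- Leaves are boxes: two points on the same side of a cut have everything between them on that
side. -/
lemma CutTree.address_eq_of_mem_uIcc : ∀ {L : ℕ} (t : CutTree d L) {x y z : Fin d → ℝ},
    (∀ j, z j ∈ Set.uIcc (x j) (y j)) → t.address x = t.address y → t.address z = t.address x
  | _, .leaf, _, _, _, _, _ => rfl
  | _, .node j γ D U, x, y, z, hz, h => by
      have hj := Set.mem_uIcc.1 (hz j)
      have hD := D.address_eq_of_mem_uIcc hz
      have hU := U.address_eq_of_mem_uIcc hz
      simp only [CutTree.address] at h ⊢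
      by_cases hx : x j ≤ γ <;> by_cases hy : y j ≤ γ
      · have hzj : z j ≤ γ := by rcases hj with hj | hj <;> linarith [hj.1, hj.2]
        simp only [hx, hy, hzj, if_true, Fin.cons_inj, true_and] at h ⊢
        exact hD h
      · simp [hx, hy, Fin.cons_inj] at h
      · simp [hx, hy, Fin.cons_inj] at h
      · have hzj : ¬ z j ≤ γ := by rcases hj with hj | hj <;> linarith [hj.1, hj.2]
        simp only [hx, hy, hzj, if_false, Fin.cons_inj, true_and] at h ⊢
        exact hU h

lemma StratTree.S_eq_of_mem_uIcc (T : StratTree b c L) {x y z : Cov b c}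
    (hz : ∀ j, z.1 j ∈ Set.uIcc (x.1 j) (y.1 j)) (h : T.S x = T.S y) : T.S z = T.S x := by
  obtain ⟨t, σ, hS⟩ := T.isTree
  rw [hS, hS] at h ⊢
  rw [t.address_eq_of_mem_uIcc hz (σ.injective h)]

/-- A function of the covariates is constant near `x` on the slice through `x`. -/
def SliceLocallyConstant {α : Type*} (C : Finset (Fin d)) (f : Cov b c → α) (x : Cov b c) : Prop :=
  ∃ r > 0, ∀ z : Cov b c, (∀ j ∉ C, z.1 j = x.1 j) → (∀ j ∈ C, |z.1 j - x.1 j| ≤ r) → f z = f x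

/-- Only points on a cutting hyperplane of a coordinate in `C` can fail, and these are null; on a
slice, the other cuts are decided by `x` itself. -/
lemma ae_sliceLocallyConstant_address
    (hC : μ.map (fun x (j : {j // j ∈ C}) => x.1 j) ≪ volume) : ∀ {L : ℕ} (t : CutTree d L),
    ∀ᵐ x ∂μ, SliceLocallyConstant C (fun x : Cov b c => t.address x.1) x
  | _, .leaf => Eventually.of_forall fun _ => ⟨1, one_pos, fun _ _ _ => rfl⟩
  | _, .node j γ D U => by
      have hne : ∀ᵐ x ∂μ, j ∈ C → x.1 j ≠ γ := by
        by_cases hj : j ∈ C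
        · exact (ae_coord_ne hC hj γ).mono fun x hx _ => hx
        · exact Eventually.of_forall fun x h => absurd h hj
      filter_upwards [hne, ae_sliceLocallyConstant_address hC D,
        ae_sliceLocallyConstant_address hC U] with x hx ⟨r, hr, hD⟩ ⟨r', hr', hU⟩
      have hside : ∃ r > 0, ∀ z : Cov b c, (∀ j ∉ C, z.1 j = x.1 j) →
          (∀ j ∈ C, |z.1 j - x.1 j| ≤ r) → (z.1 j ≤ γ ↔ x.1 j ≤ γ) := by
        by_cases hj : j ∈ C
        · have hpos : 0 < |x.1 j - γ| := abs_pos.2 (sub_ne_zero.2 (hx hj))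
          refine ⟨|x.1 j - γ| / 2, half_pos hpos, fun z _ hz => ?_⟩
          have h1 := abs_le.1 (hz j hj)
          rcases le_or_gt (x.1 j) γ with h | h
          · rw [abs_of_nonpos (by linarith)] at h1 hpos
            exact iff_of_true (by linarith [h1.2]) h
          · rw [abs_of_pos (by linarith)] at h1 hpos
            exact iff_of_false (by linarith [h1.1]) (not_le.2 h)
        · exact ⟨1, one_pos, fun z hz _ => by rw [hz j hj]⟩
      obtain ⟨r'', hr'', hs⟩ := hside
      refine ⟨min r'' (min r r'), by positivity, fun z hz hz' => ?_⟩
      have e1 := hs z hz fun j hj => (hz' j hj).trans (min_le_left _ _)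
      have e2 := hD z hz fun j hj =>
        (hz' j hj).trans ((min_le_right _ _).trans (min_le_left _ _))
      have e3 := hU z hz fun j hj =>
        (hz' j hj).trans ((min_le_right _ _).trans (min_le_right _ _))
      dsimp only at e2 e3
      simp only [CutTree.address, e1]
      split_ifs
      · rw [e2]
      · rw [e3]

lemma StratTree.ae_sliceLocallyConstant
    (hC : μ.map (fun x (j : {j // j ∈ C}) => x.1 j) ≪ volume) (T : StratTree b c L) :
    ∀ᵐ x ∂μ, SliceLocallyConstant C T.S x := by
  obtain ⟨t, σ, hS⟩ := T.isTree
  filter_upwards [ae_sliceLocallyConstant_address hC t] with x ⟨r, hr, h⟩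
  exact ⟨r, hr, fun z hz hz' => by rw [hS, hS]; exact congrArg σ (h z hz hz')⟩

lemma exists_subseq_const {α : Type*} [Finite α] (f : ℕ → α) :
    ∃ a, ∃ φ : ℕ → ℕ, StrictMono φ ∧ ∀ n, f (φ n) = a := by
  by_contra! h
  have h1 : ∀ a, ∀ᶠ n in atTop, f n ≠ a := fun a => by
    by_contra hf
    obtain ⟨φ, hφ, hφ'⟩ := extraction_of_frequently_atTop (not_eventually.1 hf)
    obtain ⟨n, hn⟩ := h a φ hφ
    exact hφ' n hn
  obtain ⟨n, hn⟩ := (eventually_all.2 h1).exists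
  exact hn _ rfl

/-- Along a monotone subsequence either `r ≤ γ` or its failure persists once it occurs. The
thresholds may be unbounded, and `r` may be their limit. -/
lemma exists_subseq_eventually_le_or (γ : ℕ → ℝ) : ∃ φ : ℕ → ℕ, StrictMono φ ∧
    ∀ r, (∀ᶠ n in atTop, r ≤ γ (φ n)) ∨ ∀ᶠ n in atTop, ¬ r ≤ γ (φ n) := by
  obtain ⟨g, hg⟩ := exists_increasing_or_nonincreasing_subseq (· ≤ ·) γ
  refine ⟨g, g.strictMono, fun r => ?_⟩
  obtain hg | hg := hg
  · by_cases h : ∃ n, r ≤ γ (g n)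
    · obtain ⟨n, hn⟩ := h
      exact Or.inl ((eventually_gt_atTop n).mono fun k hk => hn.trans (hg n k hk))
    · exact Or.inr (Eventually.of_forall fun n hn => h ⟨n, hn⟩)
  · by_cases h : ∃ n, ¬ r ≤ γ (g n)
    · obtain ⟨n, hn⟩ := h
      exact Or.inr ((eventually_gt_atTop n).mono fun k hk h => hg n k hk
        ((not_le.1 hn).le.trans h))
    · exact Or.inl (Eventually.of_forall fun n => by_contra fun hn => h ⟨n, hn⟩)

/-- Almost surely, every lower set of values of a coordinate is a sublevel set. -/
lemma exists_threshold (hC : μ.map (fun x (j : {j // j ∈ C}) => x.1 j) ≪ volume)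
    (hD : ∃ F : Finset ({j // j ∉ C} → ℝ), ∀ᵐ x ∂μ, (fun j : {j // j ∉ C} => x.1 j) ∈ F)
    (j : Fin d) {H : Set ℝ} (hH : IsLowerSet H) :
    ∃ γ, ∀ᵐ x ∂μ, x.1 j ≤ γ ↔ x.1 j ∈ H := by
  classical
  by_cases hj : j ∈ C
  · by_cases h1 : ∀ x : Cov b c, x.1 j ∈ H
    · exact ⟨c j, Eventually.of_forall fun x => iff_of_true (x.2.2 j) (h1 x)⟩
    by_cases h2 : ∀ x : Cov b c, x.1 j ∉ H
    · exact ⟨b j - 1, Eventually.of_forall fun x => iff_of_false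
        (by linarith [x.2.1 j]) (h2 x)⟩
    push Not at h1 h2
    obtain ⟨x₁, h1⟩ := h1
    obtain ⟨x₂, h2⟩ := h2
    have hbdd : BddAbove H := ⟨x₁.1 j, fun r hr => by
      by_contra hlt
      exact h1 (hH (not_le.1 hlt).le hr)⟩
    -- `H` may omit its supremum, but a continuous coordinate takes that value with probability 0.
    -- In the discrete case below, the threshold is the largest attainable value in `H`.
    refine ⟨sSup H, ?_⟩
    filter_upwards [ae_coord_ne hC hj (sSup H)] with x hx
    refine ⟨fun h => ?_, fun h => le_csSup hbdd h⟩
    obtain ⟨r, hr, hlt⟩ := exists_lt_of_lt_csSup ⟨_, h2⟩ (lt_of_le_of_ne h hx)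
    exact hH hlt.le hr
  · obtain ⟨F, hF⟩ := hD
    let G : Finset ℝ := (F.image fun v => v ⟨j, hj⟩).filter (· ∈ H)
    by_cases hG : G.Nonempty
    · refine ⟨G.max' hG, ?_⟩
      filter_upwards [hF] with x hx
      refine ⟨fun h => hH h (Finset.mem_filter.1 (G.max'_mem hG)).2, fun h => ?_⟩
      exact G.le_max' _ (Finset.mem_filter.2 ⟨Finset.mem_image.2 ⟨_, hx, rfl⟩, h⟩)
    · refine ⟨b j - 1, ?_⟩
      filter_upwards [hF] with x hx
      refine iff_of_false (by linarith [x.2.1 j]) fun h => hG ?_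
      exact ⟨_, Finset.mem_filter.2 ⟨Finset.mem_image.2 ⟨_, hx, rfl⟩, h⟩⟩

/-- A sequence of trees has a subsequence along which the leaf of every point is eventually
constant, and the limit is almost surely the partition of a tree. -/
lemma exists_subseq_address (hC : μ.map (fun x (j : {j // j ∈ C}) => x.1 j) ≪ volume)
    (hD : ∃ F : Finset ({j // j ∉ C} → ℝ), ∀ᵐ x ∂μ, (fun j : {j // j ∉ C} => x.1 j) ∈ F) :
    ∀ {L : ℕ} (t : ℕ → CutTree d L), ∃ φ : ℕ → ℕ, StrictMono φ ∧
      ∃ (t' : CutTree d L) (s : Cov b c → Fin L → Bool),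
        (∀ x, ∀ᶠ n in atTop, (t (φ n)).address x.1 = s x) ∧ ∀ᵐ x ∂μ, t'.address x.1 = s x
  | 0, t => ⟨id, strictMono_id, t 0, fun _ => Fin.elim0,
      fun _ => Eventually.of_forall fun _ => Subsingleton.elim _ _,
      Eventually.of_forall fun _ => Subsingleton.elim _ _⟩
  | L + 1, t => by
      classical
      have hnode : ∀ u : CutTree d (L + 1), ∃ j γ D U, u = .node j γ D U := fun u => by
        cases u with
        | node j γ D U => exact ⟨j, γ, D, U, rfl⟩
      choose j γ D U ht using fun n => hnode (t n)
      obtain ⟨j₀, φ₁, hφ₁, hj⟩ := exists_subseq_const j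
      obtain ⟨φ₂, hφ₂, hγ⟩ := exists_subseq_eventually_le_or (γ ∘ φ₁)
      obtain ⟨φ₃, hφ₃, D', sD, hD1, hD2⟩ :=
        exists_subseq_address hC hD (D ∘ φ₁ ∘ φ₂)
      obtain ⟨φ₄, hφ₄, U', sU, hU1, hU2⟩ :=
        exists_subseq_address hC hD (U ∘ φ₁ ∘ φ₂ ∘ φ₃)
      -- The pointwise limit of the half-lines below the thresholds; it may be open, hence a
      -- sublevel set only up to a null set.
      let H : Set ℝ := {r | ∀ᶠ n in atTop, r ≤ γ (φ₁ (φ₂ n))}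
      have hH : IsLowerSet H := fun r r' hr h => h.mono fun n hn => hr.trans hn
      obtain ⟨γ', hγ'⟩ := exists_threshold hC hD j₀ hH
      have h34 : Tendsto (φ₃ ∘ φ₄) atTop atTop := (hφ₃.comp hφ₄).tendsto_atTop
      refine ⟨φ₁ ∘ φ₂ ∘ φ₃ ∘ φ₄, hφ₁.comp (hφ₂.comp (hφ₃.comp hφ₄)), .node j₀ γ' D' U',
        fun x => if x.1 j₀ ∈ H then Fin.cons false (sD x) else Fin.cons true (sU x), ?_, ?_⟩
      · intro x
        have hd := hφ₄.tendsto_atTop.eventually (hD1 x)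
        by_cases hx : x.1 j₀ ∈ H
        · filter_upwards [hd, h34.eventually hx] with n h1 h2
          simp only [Function.comp_apply] at h1 h2 ⊢
          rw [ht, CutTree.address, hj, if_pos h2, h1, if_pos hx]
        · filter_upwards [hU1 x, h34.eventually ((hγ (x.1 j₀)).resolve_left hx)] with n h1 h2
          simp only [Function.comp_apply] at h1 h2 ⊢
          rw [ht, CutTree.address, hj, if_neg h2, h1, if_neg hx]
      · filter_upwards [hγ', hD2, hU2] with x h1 h2 h3
        simp only [CutTree.address, h1, h2, h3]

/-- Sequential compactness of the stratification trees up to null sets. -/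
lemma exists_subseq_stratTree (hC : μ.map (fun x (j : {j // j ∈ C}) => x.1 j) ≪ volume)
    (hD : ∃ F : Finset ({j // j ∉ C} → ℝ), ∀ᵐ x ∂μ, (fun j : {j // j ∉ C} => x.1 j) ∈ F)
    (T : ℕ → StratTree b c L) :
    ∃ φ : ℕ → ℕ, StrictMono φ ∧ ∃ (T' : StratTree b c L) (s : Cov b c → Fin (2 ^ L)),
      (∀ x, ∀ᶠ n in atTop, (T (φ n)).S x = s x) ∧ (∀ᵐ x ∂μ, T'.S x = s x) ∧
      Tendsto (fun n => (T (φ n)).π) atTop (𝓝 T'.π) := by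
  choose t σ hS using fun n => (T n).isTree
  obtain ⟨σ', φ₁, hφ₁, hσ⟩ := exists_subseq_const σ
  obtain ⟨π', hπ', φ₂, hφ₂, hπ⟩ := (isCompact_univ_pi fun _ : Fin (2 ^ L) =>
    isCompact_Icc (a := (0 : ℝ)) (b := 1)).tendsto_subseq
      (x := fun n => (T (φ₁ n)).π) fun n k _ => (T (φ₁ n)).π_mem k
  obtain ⟨φ₃, hφ₃, t', s, h1, h2⟩ := exists_subseq_address hC hD (t ∘ φ₁ ∘ φ₂)
  refine ⟨φ₁ ∘ φ₂ ∘ φ₃, hφ₁.comp (hφ₂.comp hφ₃),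
    ⟨fun x => σ' (t'.address x.1), ⟨t', σ', fun _ => rfl⟩, π', fun k => hπ' k trivial⟩,
    fun x => σ' (s x), fun x => ?_, ?_, hπ.comp hφ₃.tendsto_atTop⟩
  · filter_upwards [h1 x] with n hn
    simp only [Function.comp_apply] at hn ⊢
    rw [hS, hσ, hn]
  · filter_upwards [h2] with x hx
    rw [hx]

end Limits

/-! ### Existence of minimizers over a closed class. -/

section Closed

variable {d : ℕ} {b c : Fin d → ℝ} {L m : ℕ} {Q : Measure (Unit3 b c)} [IsProbabilityMeasure Q]
  {C : Finset (Fin d)}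

lemma measurable_covariate : Measurable fun z : Unit3 b c => z.2.2 :=
  measurable_snd.comp measurable_snd

lemma tendsto_rho {T : ℕ → StratTree b c L} {T' : StratTree b c L} {s : Cov b c → Fin (2 ^ L)}
    (hs : ∀ x, ∀ᶠ n in atTop, (T n).S x = s x)
    (hT' : ∀ᵐ x ∂(Q.map fun z => z.2.2), T'.S x = s x)
    (hπ : Tendsto (fun n => (T n).π) atTop (𝓝 T'.π)) :
    Tendsto (fun n => rho Q T' (T n)) atTop (𝓝 0) := by
  have := Measure.isProbabilityMeasure_map (μ := Q) measurable_covariate.aemeasurable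
  have h1 : ∀ k, Tendsto (fun n => (Q.map (fun z => z.2.2)).real
      ((T'.S ⁻¹' {k}) ∆ ((T n).S ⁻¹' {k}))) atTop (𝓝 0) := fun k => by
    have h := tendsto_measure_of_ae_tendsto_indicator_of_isFiniteMeasure (L := atTop)
      (μ := Q.map fun z => z.2.2) (A := ∅) (As := fun n => (T'.S ⁻¹' {k}) ∆ ((T n).S ⁻¹' {k}))
      MeasurableSet.empty (fun n => (T'.measurable_S (measurableSet_singleton k)).symmDiff
        ((T n).measurable_S (measurableSet_singleton k))) (by
          filter_upwards [hT'] with x hx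
          filter_upwards [hs x] with n hn
          simp [Set.mem_symmDiff, hx, hn])
    rw [measure_empty] at h
    exact (ENNReal.tendsto_toReal ENNReal.zero_ne_top).comp h
  have h2 : Tendsto (fun n => Real.sqrt (∑ k, (T'.π k - (T n).π k) ^ 2)) atTop (𝓝 0) := by
    have : Tendsto (fun n => ∑ k, (T'.π k - (T n).π k) ^ 2) atTop
        (𝓝 (∑ k, (T'.π k - T'.π k) ^ 2)) :=
      tendsto_finsetSum _ fun k _ => (tendsto_const_nhds.sub (tendsto_pi_nhds.1 hπ k)).pow 2
    simpa using this.sqrt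
  simpa [rho] using (tendsto_finsetSum Finset.univ fun k _ => h1 k).add h2

lemma eq_of_rho_eq_zero {T T' : StratTree b c L} (h : rho Q T T' = 0) :
    (∀ᵐ x ∂(Q.map fun z => z.2.2), T'.S x = T.S x) ∧ T'.π = T.π := by
  have := Measure.isProbabilityMeasure_map (μ := Q) measurable_covariate.aemeasurable
  have h1 : 0 ≤ ∑ k, (Q.map (fun z => z.2.2)).real ((T.S ⁻¹' {k}) ∆ (T'.S ⁻¹' {k})) :=
    Finset.sum_nonneg fun k _ => measureReal_nonneg
  have h2 : 0 ≤ ∑ k, (T.π k - T'.π k) ^ 2 := Finset.sum_nonneg fun k _ => sq_nonneg _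
  rw [rho, add_eq_zero_iff_of_nonneg h1 (Real.sqrt_nonneg _), Real.sqrt_eq_zero h2,
    Finset.sum_eq_zero_iff_of_nonneg fun k _ => measureReal_nonneg,
    Finset.sum_eq_zero_iff_of_nonneg fun k _ => sq_nonneg _] at h
  refine ⟨?_, ?_⟩
  · have h3 : ∀ᵐ x ∂(Q.map fun z => z.2.2), ∀ k, x ∉ (T.S ⁻¹' {k}) ∆ (T'.S ⁻¹' {k}) :=
      ae_all_iff.2 fun k => measure_eq_zero_iff_ae_notMem.1
        ((measureReal_eq_zero_iff).1 (h.1 k (Finset.mem_univ k)))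
    filter_upwards [h3] with x hx
    by_contra hne
    exact hx (T.S x) (Or.inl ⟨rfl, hne⟩)
  · ext k
    have := h.2 k (Finset.mem_univ k)
    linarith [pow_eq_zero_iff (two_ne_zero) |>.1 this]

/-- At points with massive corners at which the limit tree is locally constant, the strata of
trees with the bounds on the cells converge to those of every representative of the limit. -/
lemma label_eq_limit (hC : (Q.map fun z => z.2.2).map (fun x (j : {j // j ∈ C}) => x.1 j) ≪ volume)
    {ν δ : ℝ} (hδ : 0 < δ) {T : ℕ → StratTree b c L} (hT : ∀ n, CellBounds Q ν δ (T n))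
    {T' : StratTree b c L} {s : Cov b c → Fin (2 ^ L)}
    (hs : ∀ x, ∀ᶠ n in atTop, (T n).S x = s x)
    (hT' : ∀ᵐ x ∂(Q.map fun z => z.2.2), T'.S x = s x) {x : Cov b c}
    (hx : HasMassiveCorners (Q.map fun z => z.2.2) C x) (hloc : SliceLocallyConstant C T'.S x) :
    T'.S x = s x := by
  set μ := Q.map (fun z : Unit3 b c => z.2.2) with hμ
  have : IsProbabilityMeasure μ :=
    Measure.isProbabilityMeasure_map (μ := Q) measurable_covariate.aemeasurable
  have hmeas : ∀ T : StratTree b c L, MeasurableSet (T.S ⁻¹' {s x}) := fun T =>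
    T.measurable_S (measurableSet_singleton _)
  have hlim : Tendsto (fun n => μ.real ((T n).S ⁻¹' {s x})) atTop (𝓝 (μ.real (T'.S ⁻¹' {s x}))) := by
    refine (ENNReal.tendsto_toReal (by finiteness)).comp
      (tendsto_measure_of_ae_tendsto_indicator_of_isFiniteMeasure atTop (hmeas T')
        (fun n => hmeas (T n)) ?_)
    filter_upwards [hT'] with y hy
    filter_upwards [hs y] with n hn
    simp [hy, hn]
  -- The stratum of label `s x` is eventually nonempty, as it contains `x`; so it has mass above
  -- `δ`, and the bound survives in the limit.
  have hpos : δ ≤ μ.real (T'.S ⁻¹' {s x}) := by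
    refine ge_of_tendsto hlim ?_
    filter_upwards [hs x] with n hn
    have := (hT n (s x) ⟨x, hn⟩).2
    rw [hμ, map_measureReal_apply measurable_covariate (hmeas (T n))]
    exact this.le
  obtain ⟨y, hy1, hy2⟩ : ∃ y : Cov b c, s y = s x ∧ ∀ j ∈ C, y.1 j ≠ x.1 j := by
    by_contra! hno
    have h0 : μ (T'.S ⁻¹' {s x}) = 0 := by
      rw [measure_eq_zero_iff_ae_notMem]
      filter_upwards [hT', (ae_ball_iff C.countable_toSet).2
        fun j hj => ae_coord_ne hC hj (x.1 j)] with y h1 h2 h3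
      obtain ⟨j, hj, he⟩ := hno y (h1.symm.trans h3)
      exact h2 j hj he
    rw [Measure.real, h0, ENNReal.toReal_zero] at hpos
    linarith
  obtain ⟨r, hr, hloc⟩ := hloc
  -- The corner at `x` towards `y` is not null, so it meets the set where `T'.S = s`.
  obtain ⟨z, ⟨hz1, hz2⟩, hz3⟩ : ∃ z : Cov b c, ((∀ j ∉ C, z.1 j = x.1 j) ∧
      ∀ j ∈ C, z.1 j ∈ Set.uIcc (x.1 j) (y.1 j) ∧ |z.1 j - x.1 j| ≤ r) ∧ T'.S z = s z := by
    by_contra! hno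
    refine hx y.1 hy2 r hr (measure_eq_zero_iff_ae_notMem.2 ?_)
    filter_upwards [hT'] with z h1 h2 using hno z h2 h1
  have hhull : ∀ j, z.1 j ∈ Set.uIcc (x.1 j) (y.1 j) := fun j => by
    by_cases hj : j ∈ C
    · exact (hz2 j hj).1
    · rw [hz1 j hj]
      exact Set.left_mem_uIcc
  have hsz : s z = s x := by
    obtain ⟨n, h1, h2, h3⟩ := ((hs x).and ((hs y).and (hs z))).exists
    rw [← h1, ← h3]
    exact (T n).S_eq_of_mem_uIcc hhull (by rw [h1, h2, hy1])
  rw [← hloc z hz1 fun j hj => (hz2 j hj).2, hz3, hsz]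

omit [IsProbabilityMeasure Q] in
-- A finite sample sees a tree only through the labels of its points, which eventually agree with
-- those of `T'`; then only `π` varies. In strata without observations `π` is uncontrolled but has
-- factor 0.
lemma tendsto_empV {ν δ : ℝ} (hν : 0 < ν) {T : ℕ → StratTree b c L} {T' : StratTree b c L}
    (hT' : CellBounds Q ν δ T') (θ : ℝ) (w : Fin m → Obs b c)
    (hS : ∀ j, ∀ᶠ n in atTop, (T n).S (w j).2.2 = T'.S (w j).2.2)
    (hπ : Tendsto (fun n => (T n).π) atTop (𝓝 T'.π)) :
    Tendsto (fun n => empV θ w (T n)) atTop (𝓝 (empV θ w T')) := by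
  refine tendsto_finsetSum _ fun k _ => ?_
  have hk : Tendsto (fun n => (count w T' k : ℝ) / m *
      (((cellMean w T' k true (fun y => y) - cellMean w T' k false (fun y => y)) - θ) ^ 2
      + (cellVar w T' k false / (1 - (T n).π k) + cellVar w T' k true / (T n).π k))) atTop
      (𝓝 ((count w T' k : ℝ) / m *
      (((cellMean w T' k true (fun y => y) - cellMean w T' k false (fun y => y)) - θ) ^ 2
      + (cellVar w T' k false / (1 - T'.π k) + cellVar w T' k true / T'.π k)))) := by
    by_cases h0 : count w T' k = 0
    · simp [h0]
    · obtain ⟨j, hj⟩ := Finset.card_ne_zero.1 h0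
      have hb := (hT' k ⟨_, (Finset.mem_filter.1 hj).2⟩).1
      have hπk := tendsto_pi_nhds.1 hπ k
      exact tendsto_const_nhds.mul (tendsto_const_nhds.add
        ((tendsto_const_nhds.div (tendsto_const_nhds.sub hπk) (by linarith [hb.2])).add
          (tendsto_const_nhds.div hπk (hν.trans_le hb.1).ne')))
  refine hk.congr' ?_
  filter_upwards [eventually_all.2 hS] with n hn
  simp only [count, cellVar, cellMean, hn]

/-- Over a closed class, the empirical criterion has a minimizer for all samples whose covariates
avoid a null set. -/
lemma exists_isEmpMin
    (hC : (Q.map fun z => z.2.2).map (fun x (j : {j // j ∈ C}) => x.1 j) ≪ volume)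
    (hD : ∃ F : Finset ({j // j ∉ C} → ℝ), ∀ᵐ x ∂(Q.map fun z => z.2.2),
      (fun j : {j // j ∉ C} => x.1 j) ∈ F) {ν δ : ℝ} (hν : 0 < ν) (hδ : 0 < δ)
    {𝒯 : Set (StratTree b c L)} (hne : 𝒯.Nonempty) (hcell : ∀ T ∈ 𝒯, CellBounds Q ν δ T)
    (hclosed : IsClosedClass Q 𝒯) (θ : ℝ) (w : Fin m → Obs b c)
    (hcorner : ∀ j, HasMassiveCorners (Q.map fun z => z.2.2) C (w j).2.2)
    (hloc : ∀ j, ∀ T ∈ 𝒯, SliceLocallyConstant C T.S (w j).2.2) :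
    ∃ T, IsEmpMin θ w 𝒯 T := by
  -- The infimum is taken in `EReal`, so no lower bound on the criterion is needed in advance; the
  -- limit shows that it is finite.
  obtain ⟨u, -, hu, hmem⟩ := exists_seq_tendsto_sInf
    (hne.image fun T => (empV θ w T : EReal)) (OrderBot.bddBelow _)
  choose T hT hTu using hmem
  obtain ⟨φ, hφ, T₁, s, hs, hT₁, hπ⟩ := exists_subseq_stratTree hC hD T
  have hrho := tendsto_rho hs hT₁ hπ
  obtain ⟨T', hT', h0⟩ := hclosed T₁ fun ε hε => by
    obtain ⟨n, hn⟩ := (hrho.eventually (gt_mem_nhds hε)).exists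
    exact ⟨_, hT _, hn⟩
  obtain ⟨h1, h2⟩ := eq_of_rho_eq_zero h0
  have hT's : ∀ᵐ x ∂(Q.map fun z => z.2.2), T'.S x = s x := by
    filter_upwards [h1, hT₁] with x h1 h2 using h1.trans h2
  have hlim := tendsto_empV hν (hcell T' hT') θ w (T := fun n => T (φ n)) (fun j => by
    rw [label_eq_limit hC hδ (fun n => hcell _ (hT (φ n))) hs hT's (hcorner j) (hloc j T' hT')]
    exact hs _) (by rwa [h2])
  have heq := tendsto_nhds_unique (EReal.tendsto_coe.2 hlim)
    ((hu.comp hφ.tendsto_atTop).congr fun n => (hTu _).symm)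
  refine ⟨T', hT', fun T'' hT'' => ?_⟩
  rw [← EReal.coe_le_coe_iff, heq]
  exact sInf_le ⟨T'', hT'', rfl⟩

end Closed

end StratTrees

end

/-- The empirical variance minimizer over a countable class of stratification trees.
`θhat` is the estimate of `E[Y(1) - Y(0)]` in the empirical variance, in either normalization.
(i) Every sequence of minimizers has `V(T̂_m) → V*` almost surely.
(ii) If minimizers exist almost surely, they can be chosen as a function of the pilot data of
size `m` that is measurable for every sigma-algebra on the trees.
(iii) If the class is closed, minimizers exist almost surely. -/
theorem proposition3p1 {Ω : Type*} [MeasurableSpace Ω] (P : MeasureTheory.Measure Ω)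
    [MeasureTheory.IsProbabilityMeasure P]
    {d : ℕ} {b c : Fin d → ℝ} (L : ℕ)
    (Q : MeasureTheory.Measure (StratTrees.Unit3 b c)) (M : ℝ) (C : Finset (Fin d))
    (hQ : StratTrees.BoundedPopulation Q M C)
    (p : ℝ) (hp : p ∈ Set.Ioo (0 : ℝ) 1)
    (Z : ℕ → Ω → StratTrees.Unit3 b c) (A : ℕ → Ω → Bool)
    (hZA : StratTrees.SimpleRandomAssignment P Q p Z A)
    (ν δ : ℝ) (hν : 0 < ν) (hδ : 0 < δ)
    (𝒯 : Set (StratTrees.StratTree b c L)) (hne : 𝒯.Nonempty) (hcount : 𝒯.Countable)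
    (hcell : ∀ T ∈ 𝒯, StratTrees.CellBounds Q ν δ T)
    (θhat : (m : ℕ) → (Fin m → StratTrees.Obs b c) → ℝ)
    (hθ : (θhat = fun _ w => StratTrees.ateArmNormalized w) ∨
      (θhat = fun _ w => StratTrees.ateSampleNormalized w)) :
    (∀ That : ℕ → Ω → StratTrees.StratTree b c L,
      (∀ᵐ ω ∂P, ∀ m, StratTrees.IsEmpMin (θhat m (StratTrees.pilot Z A m ω))
        (StratTrees.pilot Z A m ω) 𝒯 (That m ω)) →
      ∀ᵐ ω ∂P, Filter.Tendsto (fun m => StratTrees.V Q (That m ω)) Filter.atTop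
        (nhds (sInf (StratTrees.V Q '' 𝒯)))) ∧
    ((∀ᵐ ω ∂P, ∀ m, ∃ T, StratTrees.IsEmpMin (θhat m (StratTrees.pilot Z A m ω))
        (StratTrees.pilot Z A m ω) 𝒯 T) →
      ∃ That : ℕ → Ω → StratTrees.StratTree b c L,
        (∀ m, ∀ B : Set (StratTrees.StratTree b c L),
          MeasurableSet[MeasurableSpace.comap (StratTrees.pilot Z A m) inferInstance]
            (That m ⁻¹' B)) ∧
        ∀ᵐ ω ∂P, ∀ m, StratTrees.IsEmpMin (θhat m (StratTrees.pilot Z A m ω))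
          (StratTrees.pilot Z A m ω) 𝒯 (That m ω)) ∧
    (StratTrees.IsClosedClass Q 𝒯 →
      ∀ᵐ ω ∂P, ∀ m, ∃ T, StratTrees.IsEmpMin (θhat m (StratTrees.pilot Z A m ω))
        (StratTrees.pilot Z A m ω) 𝒯 T) := by
  have := hZA.isProbabilityMeasure
  have hM := hQ.bounded
  refine ⟨fun That hmin => ?_, fun hex => ?_, fun hclosed => ?_⟩
  · obtain rfl | rfl := hθ
    · exact hZA.ae_tendsto_V hp hM hν hδ hne hcell (hZA.ae_tendsto_ateArmNormalized hp hM) hmin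
    · exact hZA.ae_tendsto_V hp hM hν hδ hne hcell (hZA.ae_tendsto_ateSampleNormalized hp hM) hmin
  · have hθm : ∀ m, Measurable (θhat m) := fun m => by
      obtain rfl | rfl := hθ
      · exact StratTrees.measurable_ateArmNormalized
      · exact StratTrees.measurable_ateSampleNormalized
    choose τ hτ hτ' using fun m => StratTrees.exists_measurable_minimizer hne hcount (hθm m)
    refine ⟨fun m ω => τ m (StratTrees.pilot Z A m ω), fun m B => ⟨_, hτ m B, rfl⟩, ?_⟩
    filter_upwards [hex] with ω hω m using hτ' m _ (hω m)
  · have hmC : Measurable fun (x : StratTrees.Cov b c) (j : {j // j ∈ C}) => x.1 j :=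
      measurable_pi_lambda _ fun j => (measurable_pi_apply _).comp measurable_subtype_coe
    have hmD : Measurable fun (x : StratTrees.Cov b c) (j : {j // j ∉ C}) => x.1 j :=
      measurable_pi_lambda _ fun j => (measurable_pi_apply _).comp measurable_subtype_coe
    have hC : (Q.map fun z => z.2.2).map (fun x (j : {j // j ∈ C}) => x.1 j) ≪ volume := by
      obtain ⟨f, -, -, -, hf⟩ := hQ.continuous_part
      rw [Measure.map_map hmC StratTrees.measurable_covariate]
      exact hf ▸ (withDensity_absolutelyContinuous _ _).trans
        Measure.restrict_le_self.absolutelyContinuous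
    have hD : ∃ F : Finset ({j // j ∉ C} → ℝ), ∀ᵐ x ∂(Q.map fun z => z.2.2),
        (fun j : {j // j ∉ C} => x.1 j) ∈ F := by
      obtain ⟨F, hF⟩ := hQ.discrete_part
      exact ⟨F, (ae_map_iff StratTrees.measurable_covariate.aemeasurable
        (hmD F.measurableSet)).2 hF⟩
    -- A null set independent of the sample: corners involve only the law of `X`, and local
    -- constancy is asked of countably many trees.
    have hgood : ∀ᵐ x ∂(Q.map fun z => z.2.2),
        StratTrees.HasMassiveCorners (Q.map fun z => z.2.2) C x ∧
          ∀ T ∈ 𝒯, StratTrees.SliceLocallyConstant C T.S x :=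
      have := Measure.isProbabilityMeasure_map (μ := Q)
        StratTrees.measurable_covariate.aemeasurable
      (StratTrees.ae_hasMassiveCorners hC hD).and
        ((ae_ball_iff hcount).2 fun T _ => T.ae_sliceLocallyConstant hC)
    have hdata : ∀ᵐ ω ∂P, ∀ i, StratTrees.HasMassiveCorners (Q.map fun z => z.2.2) C (Z i ω).2.2 ∧
        ∀ T ∈ 𝒯, StratTrees.SliceLocallyConstant C T.S (Z i ω).2.2 := by
      refine ae_all_iff.2 fun i => ?_
      have h := ae_of_ae_map StratTrees.measurable_covariate.aemeasurable hgood
      rw [← hZA.law_Z i] at h ⊢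
      exact ae_of_ae_map (hZA.measurable_Z i).aemeasurable h
    filter_upwards [hdata] with ω hω m
    exact StratTrees.exists_isEmpMin hC hD hν hδ hne hcell hclosed _ _
      (fun j => (hω j).1) fun j => (hω j).2
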